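/- Let $d\ge 2$ and $\mathbb I=[0,1]$. A $d$-dimensional copula $C$ is the function $C(\mathbf u)=\mu_C([\mathbf 0,\mathbf u])$ on $\mathbb I^d$, where $\mu_C$ is a Borel probability measure on $\mathbb I^d$ with uniform one-dimensional marginals. Let $\mathcal C^d$ be the set of all of them, with the uniform metric $d_\infty(C,D)=\sup_{\mathbf u\in\mathbb I^d}|C(\mathbf u)-D(\mathbf u)|$. For $J\subseteq\{1,\dots,d\}$ let $C_J$ be the marginal of $C$ on the coordinates in $J$, and for $j\notin L$ let $F_{j|L}(\cdot\,|\,\mathbf t)$ be the conditional distribution function of coordinate $j$ given that the coordinates in $L$ equal $\mathbf t$. Let $\mathcal C^d_c$ be the set of all $C\in\mathcal C^d$ such that, for all $L$ with $1\le|L|\le d-2$ and all $j\notin L$, the function $F_{j|L}(\cdot\,|\,\mathbf t)$ is continuous for $\mu_{C_L}$-almost every $\mathbf t$. For $C\in\mathcal C^d_c$, $i+2\le k$ and $L=\{i+1,\dots,k-1\}$, let $(C^{\mathbf w}_{ik;L})_{\mathbf w}$ be a measurable family of bivariate copulas such that, for $\mu_{C_L}$-almost every $\mathbf w$, the conditional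 joint distribution function of the coordinates $i,k$ given $\mathbf w$ is $(a,b)\mapsto C^{\mathbf w}_{ik;L}(F_{i|L}(a|\mathbf w),F_{k|L}(b|\mathbf w))$; this family is unique up to $\mu_{C_L}$-null sets. A partial D-vine copula of $C\in\mathcal C^d_c$ is a copula $D\in\mathcal C^d$ such that $D_{i,i+1}=C_{i,i+1}$ for $1\le i\le d-1$ and, for all $i,k$ with $i+2\le k\le d$, with $L=\{i+1,\dots,k-1\}$ and some version of $(C^{\mathbf w}_{ik;L})_{\mathbf w}$, $$D_{\{i,\dots,k\}}(\mathbf u)=\int_{[\mathbf 0,\mathbf u_L]}(C_p)_{ik}\bigl(F^{D}_{i|L}(u_i|\mathbf t),F^{D}_{k|L}(u_k|\mathbf t)\bigr)\,d\mu_{D_L}(\mathbf t),\qquad (C_p)_{ik}(a,b)=\int_{\mathbb I^{L}} C^{\mathbf w}_{ik;L}(a,b)\,d\mu_{D_L}(\mathbf w),$$ where $F^D_{j|L}$ denotes the conditional distribution functions of $D$. A partial D-vine map is a map $\psi:\mathcal C^d_c\to\mathcal C^d$ sending every $C$ to a partial D-vine copula of $C$. **Theorem.** A partial D-vine map exists,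 and every partial D-vine map $\psi$ has the following properties. 1. Every $C\in\mathcal C^d_c$ with $d_\infty(C,\psi(C))\neq0$ (equivalently, $\psi(C)\ne C$) is a discontinuity point of $\psi$ with respect to $d_\infty$. 2. If $d\ge 3$, then the set of discontinuity points of $\psi$ is dense in $(\mathcal C^d_c,d_\infty)$. -/

import Mathlib

open MeasureTheory ProbabilityTheory

noncomputable section

/-- A Borel measure on the cube `[0,1]ᵈ` is `d`-stochastic if it is a probability measure all of
whose one-dimensional marginals are uniform on `[0,1]` (`volume` on `unitInterval`). -/
structure IsStochastic {d : ℕ} (μ : Measure (Fin d → unitInterval)) : Prop where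
  isProbabilityMeasure : IsProbabilityMeasure μ
  map_eval : ∀ i, μ.map (fun x => x i) = volume

/-- A `d`-dimensional copula `C`, given by its `d`-stochastic measure `μ_C`; the copula as a
function is `C(u) = μ_C([0,u])`, see the coercion below (the measure and the function determine
each other). -/
structure Copula (d : ℕ) where
  /-- The `d`-stochastic measure `μ_C`. -/
  measure : Measure (Fin d → unitInterval)
  isStochastic : IsStochastic measure

namespace Copula

variable {d : ℕ}

instance (C : Copula d) : IsProbabilityMeasure C.measure :=
  C.isStochastic.isProbabilityMeasure

/-- `C(u) = μ_C([0,u])`. -/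
instance : CoeFun (Copula d) (fun _ => (Fin d → unitInterval) → ℝ) :=
  ⟨fun C u => C.measure.real (Set.Iic u)⟩

theorem ext_of_apply {C D : Copula d} (h : ∀ u, C u = D u) : C = D := by
  have key : C.measure = D.measure := by
    refine ext_of_generate_finite
      (Set.pi Set.univ '' Set.pi Set.univ fun _ : Fin d => Set.range (Set.Iic : unitInterval → _))
      ?_ ?_ ?_ ?_
    · symm
      have hb : (inferInstance : MeasurableSpace unitInterval)
          = MeasurableSpace.generateFrom (Set.range Set.Iic) := by
        rw [BorelSpace.measurable_eq (α := unitInterval), borel_eq_generateFrom_Iic]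
      refine generateFrom_eq_pi (fun _ => hb.symm) fun _ => ⟨fun _ => Set.univ, fun _ => ?_, ?_⟩
      · exact ⟨1, Set.eq_univ_of_forall fun x => unitInterval.le_one'⟩
      · exact Set.iUnion_const _
    · refine IsPiSystem.pi fun _ => ?_
      rintro _ ⟨a, rfl⟩ _ ⟨b, rfl⟩ -
      exact ⟨a ⊓ b, Set.Iic_inter_Iic.symm⟩
    · rintro _ ⟨s, hs, rfl⟩
      choose u hu using fun i => hs i (Set.mem_univ i)
      have : Set.pi Set.univ s = Set.Iic u := by
        rw [← Set.pi_univ_Iic]; congr 1; funext i; exact (hu i).symm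
      rw [this]
      exact (measureReal_eq_measureReal_iff).1 (h u)
    · simp
  cases C; cases D; cases key; rfl

theorem abs_sub_le_one (C D : Copula d) (u : Fin d → unitInterval) : |C u - D u| ≤ 1 := by
  have h1 : C u ≤ 1 := measureReal_le_one
  have h2 : D u ≤ 1 := measureReal_le_one
  have h3 : 0 ≤ C u := measureReal_nonneg
  have h4 : 0 ≤ D u := measureReal_nonneg
  rw [abs_le]; constructor <;> linarith

theorem bddAbove_dist (C D : Copula d) : BddAbove (Set.range fun u => |C u - D u|) :=
  ⟨1, by rintro _ ⟨u, rfl⟩; exact abs_sub_le_one C D u⟩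

/-- The uniform metric `d_∞(C, D) = sup_u |C(u) - D(u)|` on the set of all `d`-dimensional
copulas. -/
instance : MetricSpace (Copula d) where
  dist C D := ⨆ u, |C u - D u|
  dist_self C := by simp
  dist_comm C D := by simp only [abs_sub_comm]
  dist_triangle C D E := ciSup_le fun u =>
    (abs_sub_le (C u) (D u) (E u)).trans
      (add_le_add (le_ciSup (bddAbove_dist C D) u) (le_ciSup (bddAbove_dist D E) u))
  eq_of_dist_eq_zero {C D} h := ext_of_apply fun u => by
    have h1 : |C u - D u| ≤ ⨆ u, |C u - D u| := le_ciSup (bddAbove_dist C D) u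
    have h2 : (⨆ u, |C u - D u|) = 0 := h
    rw [h2] at h1
    exact sub_eq_zero.1 (abs_nonpos_iff.1 h1)

/-- The marginal `C_J` of `C` with respect to the coordinates in `J`, as a measure on `[0,1]ᴶ`. -/
def marginal (C : Copula d) (J : Finset (Fin d)) : Measure (J → unitInterval) :=
  C.measure.map J.restrict

/-- The regular conditional distribution of the pair of coordinates `(i, k)` given the coordinates
in `L` (a Markov kernel, unique up to `C_L`-null sets). -/
def condPair (C : Copula d) (i k : Fin d) (L : Finset (Fin d)) :
    Kernel (L → unitInterval) (Fin 2 → unitInterval) :=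
  condDistrib (fun x => ![x i, x k]) L.restrict C.measure

/-- The conditional univariate distribution function `F_{j|L}(a | t)`, i.e. the value at `[0,a]` of
the regular conditional distribution of coordinate `j` given that the coordinates in `L` equal `t`.
-/
def condCDF (C : Copula d) (j : Fin d) (L : Finset (Fin d)) (a : unitInterval)
    (t : L → unitInterval) : unitInterval :=
  ⟨(condDistrib (fun x => x j) L.restrict C.measure t).real (Set.Iic a),
    measureReal_nonneg, measureReal_le_one⟩

/-- `C` has continuous conditional univariate marginal distribution functions: for all `L` with
`1 ≤ |L| ≤ d - 2` and all `j ∉ L`, the function `F_{j|L}(· | t)` is continuous for `C_L`-almost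
every `t`. -/
def HasContinuousCondCDFs (C : Copula d) : Prop :=
  ∀ (L : Finset (Fin d)) (j : Fin d), L.Nonempty → L.card + 2 ≤ d → j ∉ L →
    ∀ᵐ t ∂(C.marginal L), Continuous fun a => C.condCDF j L a t

/-- `A` is a (measurable) version of the conditional copulas `w ↦ C^w_{ik;L}`: each `A w` is a
bivariate copula and Sklar's identity
`K_C(w, [0,a] × [0,b]) = C^w_{ik;L}(F_{i|L}(a|w), F_{k|L}(b|w))`
holds for `C_L`-almost every `w` and all `a, b`. -/
structure IsCondCopula (C : Copula d) (i k : Fin d) (L : Finset (Fin d))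
    (A : Kernel (L → unitInterval) (Fin 2 → unitInterval)) : Prop where
  isStochastic : ∀ w, IsStochastic (A w)
  sklar : ∀ᵐ w ∂(C.marginal L), ∀ a b : unitInterval,
    (C.condPair i k L w).real (Set.Iic ![a, b])
      = (A w).real (Set.Iic ![C.condCDF i L a w, C.condCDF k L b w])

/-- `D` is a partial vine copula of D-vine structure of `C`.

* First step: `D_{i,i+1} = C_{i,i+1}`.
* Later steps: for `i + 2 ≤ k` put `L = {i+1, …, k-1}`. The bivariate partial copula is
  `(C_p)_{ik}(a,b) = ∫ C^w_{ik;L}(a,b) dμ_{D_L}(w)`, and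
  `D_{i,…,k}(u) = ∫_{[0,u_L]} (C_p)_{ik}(F^D_{i|L}(u_i|t), F^D_{k|L}(u_k|t)) dμ_{D_L}(t)`.

The steps determine the marginals of `D` on blocks of consecutive coordinates one after the other,
in the order of the block length. Every choice `A` of a version of the conditional copulas
`C^w_{ik;L}` is admitted: these are determined by `C` only up to `C_L`-null sets, and for blocks of
length at least five such a set need not be null for `D_L`. -/
structure IsPartialDVine (C D : Copula d) : Prop where
  pairs : ∀ i k : Fin d, (i : ℕ) + 1 = k → D.marginal {i, k} = C.marginal {i, k}
  blocks : ∀ i k : Fin d, (i : ℕ) + 2 ≤ k →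
    ∃ A : Kernel (Finset.Ioo i k → unitInterval) (Fin 2 → unitInterval),
      C.IsCondCopula i k (Finset.Ioo i k) A ∧
      ∀ u : Fin d → unitInterval,
        (D.marginal (Finset.Icc i k)).real (Set.Iic ((Finset.Icc i k).restrict u))
          = ∫ t in Set.Iic ((Finset.Ioo i k).restrict u),
              (∫ w, (A w).real
                  (Set.Iic ![D.condCDF i (Finset.Ioo i k) (u i) t,
                    D.condCDF k (Finset.Ioo i k) (u k) t])
                ∂(D.marginal (Finset.Ioo i k)))
              ∂(D.marginal (Finset.Ioo i k))

end Copula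

/-- The family `C^d_c` of all `d`-dimensional copulas having continuous conditional univariate
marginal distribution functions, a metric space with the restriction of `d_∞`. -/
abbrev ContCopula (d : ℕ) : Type := {C : Copula d // C.HasContinuousCondCDFs}

/-- `ψ` is a partial D-vine map: it assigns to every `C` in `C^d_c` a partial vine copula of
D-vine structure of `C`. -/
def IsPartialDVineMap {d : ℕ} (ψ : ContCopula d → Copula d) : Prop :=
  ∀ C : ContCopula d, C.1.IsPartialDVine (ψ C)

end

open scoped ENNReal Topology

noncomputable section

/-! Both properties rest on the fact that copulas fixed by every partial D-vine map are dense. Given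
`C` and a fine grid, each grid interval of each coordinate `j` is cut into pieces indexed by the
grid cells `z` with that `j`-th index, the piece of `z` having length `μ_C(z)`; uniformity of the
marginals makes the lengths fit (`Copula.exists_intervalCoding`). Choose `z` with probability
`μ_C(z)`, then a uniform point of the product of the pieces labelled `z`. The result is a copula
with the same grid masses as `C`, hence close to `C`, and any single coordinate reveals `z`. So,
given any nonempty set of coordinates, the others are independent; all conditional copulas are the
independence copula, and the partial D-vine copula is the copula itself
(`Copula.IsCondIndep.eq_of_isPartialDVine`). If `ψ` is continuous at `C`, fixed points `E` tending
to `C` satisfy `E = ψ E → ψ C`, whence `ψ C = C`.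

For density, the same construction is spoiled in a single box: there the pair `(i, k)`, with
coordinates in between, is conditioned to lie on the same side of its medians. This keeps every
univariate marginal, so the mixture stays close to `C`. Its conditional copula takes the value 1/2
at (1/2, 1/2) given this box and 1/4 given another one, whereas a partial D-vine copula uses one
averaged copula for all conditioning values. Hence the mixture is not its own partial D-vine copula
and `ψ` moves it (`IntervalCoding.exists_boxFamily_not_isPartialDVine_self`).

Existence of `ψ`: conditional copulas come from Sklar's theorem applied fibrewise
(`Copula.exists_isCondCopula`), and the equations are solved one pair at a time by redrawing one
coordinate (`Copula.exists_glue_block`, `Copula.exists_pairs_blocks`). -/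

/-! ### Measures on the unit interval and cubes, distribution and quantile functions -/

theorem ext_of_pi_Iic {J : Type*} [Fintype J] {μ ν : Measure (J → unitInterval)}
    [IsFiniteMeasure μ] (h : ∀ u, μ (Set.Iic u) = ν (Set.Iic u)) : μ = ν := by
  refine ext_of_generate_finite
    (Set.pi Set.univ '' Set.pi Set.univ fun _ : J => Set.range (Set.Iic : unitInterval → _))
    ?_ ?_ ?_ ?_
  · symm
    have hb : (inferInstance : MeasurableSpace unitInterval)
        = MeasurableSpace.generateFrom (Set.range Set.Iic) := by
      rw [BorelSpace.measurable_eq (α := unitInterval), borel_eq_generateFrom_Iic]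
    refine generateFrom_eq_pi (fun _ => hb.symm) fun _ => ⟨fun _ => Set.univ, fun _ => ?_, ?_⟩
    · exact ⟨1, Set.eq_univ_of_forall fun x => unitInterval.le_one'⟩
    · exact Set.iUnion_const _
  · refine IsPiSystem.pi fun _ => ?_
    rintro _ ⟨a, rfl⟩ _ ⟨b, rfl⟩ -
    exact ⟨a ⊓ b, Set.Iic_inter_Iic.symm⟩
  · rintro _ ⟨s, hs, rfl⟩
    choose u hu using fun i => hs i (Set.mem_univ i)
    have : Set.pi Set.univ s = Set.Iic u := by
      rw [← Set.pi_univ_Iic]; congr 1; funext i; exact (hu i).symm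
    rw [this]
    exact h u
  · have := h 1
    rwa [show Set.Iic (1 : J → unitInterval) = Set.univ from
      Set.eq_univ_of_forall fun x i => unitInterval.le_one'] at this

theorem ext_of_Iic_unitInterval {μ ν : Measure unitInterval} [IsFiniteMeasure μ]
    (h : ∀ a, μ (Set.Iic a) = ν (Set.Iic a)) : μ = ν := Measure.ext_of_Iic μ ν h

theorem volume_real_Iic (a : unitInterval) :
    (volume : Measure unitInterval).real (Set.Iic a) = a := by
  simp [Measure.real, a.2.1]

theorem continuous_measureReal_Iic (μ : Measure unitInterval) [IsFiniteMeasure μ]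
    [NullSingletonClass μ] : Continuous fun a => μ.real (Set.Iic a) := by
  have h : ∀ a, μ.real (Set.Iic a) = ∫ y, (Set.Ici y).indicator (fun _ => (1 : ℝ)) a ∂μ := by
    intro a
    rw [show (fun y => (Set.Ici y).indicator (fun _ => (1 : ℝ)) a)
      = (Set.Iic a).indicator 1 from ?_, integral_indicator_one measurableSet_Iic]
    funext y; simp [Set.indicator]
  simp_rw [h]
  rw [continuous_iff_continuousAt]
  intro a
  refine continuousAt_of_dominated (bound := fun _ => 1) ?_ ?_ (integrable_const _) ?_
  · refine Filter.Eventually.of_forall fun b => ?_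
    rw [show (fun y => (Set.Ici y).indicator (fun _ => (1 : ℝ)) b)
      = (Set.Iic b).indicator 1 from ?_]
    · exact (measurable_one.indicator measurableSet_Iic).aestronglyMeasurable
    funext y; simp [Set.indicator]
  · refine Filter.Eventually.of_forall fun b => Filter.Eventually.of_forall fun y => ?_
    simp only [Set.indicator]; split_ifs <;> simp
  · have : ∀ᵐ y ∂μ, y ≠ a := by simp [ae_iff]
    filter_upwards [this] with y hy
    rcases lt_or_gt_of_ne hy with h | h
    · refine (continuousAt_const (y := (1 : ℝ))).congr ?_
      filter_upwards [lt_mem_nhds h] with b hb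
      simp [Set.indicator, hb.le]
    · refine (continuousAt_const (y := (0 : ℝ))).congr ?_
      filter_upwards [gt_mem_nhds h] with b hb
      simp [Set.indicator, hb]

/-- The distribution function of a probability measure on the unit interval. -/
def distFun (m : Measure unitInterval) [IsProbabilityMeasure m] (a : unitInterval) :
    unitInterval :=
  ⟨m.real (Set.Iic a), measureReal_nonneg, measureReal_le_one⟩

section distFun

variable (m : Measure unitInterval) [IsProbabilityMeasure m]

theorem distFun_mono : Monotone (distFun m) := fun _ _ h =>
  Subtype.mk_le_mk.2 (measureReal_mono (Set.Iic_subset_Iic.2 h))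

theorem distFun_one : distFun m 1 = 1 := by
  have : Set.Iic (1 : unitInterval) = Set.univ :=
    Set.eq_univ_of_forall fun x => unitInterval.le_one'
  ext; simp [distFun, this]

variable {m}

theorem distFun_surjective (hc : Continuous (distFun m)) (h0 : distFun m 0 = 0) :
    Function.Surjective (distFun m) := by
  intro v
  have h := intermediate_value_Icc (zero_le_one : (0 : unitInterval) ≤ 1) hc.continuousOn
  rw [h0, distFun_one] at h
  obtain ⟨a, -, ha⟩ := h ⟨unitInterval.nonneg', unitInterval.le_one'⟩
  exact ⟨a, ha⟩

theorem exists_distFun_le_iff (hc : Continuous (distFun m)) (h0 : distFun m 0 = 0)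
    (v : unitInterval) : ∃ a, distFun m a = v ∧ {y | distFun m y ≤ v} = Set.Iic a := by
  set S := {y | distFun m y ≤ v}
  have hcl : IsClosed S := isClosed_le hc continuous_const
  have hne : S.Nonempty := ⟨0, by simp [S, h0]⟩
  have hmem : sSup S ∈ S := hcl.sSup_mem hne
  obtain ⟨b, hb⟩ := distFun_surjective hc h0 v
  refine ⟨sSup S, le_antisymm hmem ?_, ?_⟩
  · rw [← hb]
    exact distFun_mono m (le_sSup (show b ∈ S from hb.le))
  · ext y
    exact ⟨fun h => le_sSup h, fun h => (distFun_mono m h).trans hmem⟩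

theorem map_distFun (hc : Continuous (distFun m)) (h0 : distFun m 0 = 0) :
    m.map (distFun m) = volume := by
  have := Measure.isProbabilityMeasure_map (μ := m) hc.measurable.aemeasurable
  refine ext_of_Iic_unitInterval fun v => ?_
  rw [Measure.map_apply hc.measurable measurableSet_Iic]
  obtain ⟨a, ha, hS⟩ := exists_distFun_le_iff hc h0 v
  change m {y | distFun m y ≤ v} = _
  rw [hS, ← measureReal_eq_measureReal_iff, volume_real_Iic]
  exact congrArg Subtype.val ha

/-- The distribution function may be flat to the right of `a`, but the flat piece carries no mass.
-/
theorem distFun_le_iff_ae (hc : Continuous (distFun m)) (h0 : distFun m 0 = 0)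
    (a : unitInterval) : ∀ᵐ y ∂m, distFun m y ≤ distFun m a ↔ y ≤ a := by
  obtain ⟨b, hb, hS⟩ := exists_distFun_le_iff hc h0 (distFun m a)
  have hab : Set.Iic a ⊆ Set.Iic b := by
    rw [← hS]; exact fun y hy => distFun_mono m hy
  have h : m (Set.Iic b \ Set.Iic a) = 0 := by
    rw [measure_sdiff hab measurableSet_Iic.nullMeasurableSet (measure_ne_top _ _)]
    have : m (Set.Iic b) = m (Set.Iic a) :=
      (measureReal_eq_measureReal_iff).1 (congrArg (Subtype.val : unitInterval → ℝ) hb)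
    simp [this]
  have h' : ∀ᵐ y ∂m, y ∉ Set.Iic b \ Set.Iic a := measure_eq_zero_iff_ae_notMem.1 h
  filter_upwards [h'] with y hy
  refine ⟨fun h1 => ?_, fun h1 => distFun_mono m h1⟩
  by_contra h2
  exact hy ⟨by rw [← hS]; exact h1, h2⟩

end distFun

section kernel

variable {T : Type*} [MeasurableSpace T] (κ : Kernel T unitInterval) [IsMarkovKernel κ]

theorem measurable_distFun_kernel :
    Measurable fun p : T × unitInterval => distFun (κ p.1) p.2 := by
  have h : Measurable fun p : T × unitInterval => κ p.1 (Set.Iic p.2) :=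
    Kernel.measurable_kernel_prodMk_left (κ := Kernel.prodMkRight unitInterval κ)
      (t := {q | q.2 ≤ q.1.2}) (measurableSet_le (by fun_prop) (by fun_prop))
  exact Measurable.subtype_mk h.ennreal_toReal

/-- The quantile functions of a family of probability measures on the unit interval. -/
def quantile (t : T) (v : unitInterval) : unitInterval := sInf {a | v ≤ distFun (κ t) a}

/-- Right-continuity of the distribution function makes the infimum attained. -/
theorem quantile_le_iff (t : T) (v a : unitInterval) :
    quantile κ t v ≤ a ↔ v ≤ distFun (κ t) a := by
  refine ⟨fun h => ?_, fun h => sInf_le h⟩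
  refine le_trans ?_ (distFun_mono _ h)
  have hne : {a | v ≤ distFun (κ t) a}.Nonempty :=
    ⟨1, by simpa [distFun_one] using unitInterval.le_one'⟩
  obtain ⟨u, hu, hlim, hmem⟩ := exists_seq_tendsto_sInf hne (OrderBot.bddBelow _)
  have hI : ⋂ n, Set.Iic (u n) = Set.Iic (quantile κ t v) := by
    ext y
    simp only [Set.mem_iInter, Set.mem_Iic]
    exact ⟨fun h => ge_of_tendsto' hlim h, fun h n => h.trans (sInf_le (hmem n))⟩
  have h1 := tendsto_measure_iInter_atTop (μ := κ t) (s := fun n => Set.Iic (u n))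
    (fun n => measurableSet_Iic.nullMeasurableSet)
    (fun m n hmn => Set.Iic_subset_Iic.2 (hu hmn)) ⟨0, measure_ne_top _ _⟩
  rw [hI] at h1
  have h2 := (ENNReal.tendsto_toReal (measure_ne_top _ _)).comp h1
  exact Subtype.coe_le_coe.1 (ge_of_tendsto' h2 fun n =>
    show (v : ℝ) ≤ (distFun (κ t) (u n) : ℝ) from hmem n)

theorem measurable_quantile : Measurable fun p : T × unitInterval => quantile κ p.1 p.2 := by
  refine measurable_of_Iic fun a => ?_
  have : (fun p : T × unitInterval => quantile κ p.1 p.2) ⁻¹' Set.Iic a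
      = {p | p.2 ≤ distFun (κ p.1) a} := by
    ext p; exact quantile_le_iff κ p.1 p.2 a
  rw [this]
  exact measurableSet_le measurable_snd
    ((measurable_distFun_kernel κ).comp (measurable_fst.prodMk measurable_const))

theorem map_quantile (t : T) : volume.map (quantile κ t) = κ t := by
  have hm : Measurable (quantile κ t) := (measurable_quantile κ).comp measurable_prodMk_left
  have := Measure.isProbabilityMeasure_map
    (μ := (volume : Measure unitInterval)) hm.aemeasurable
  refine ext_of_Iic_unitInterval fun a => ?_
  rw [Measure.map_apply hm measurableSet_Iic, ← measureReal_eq_measureReal_iff]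
  have : quantile κ t ⁻¹' Set.Iic a = Set.Iic (distFun (κ t) a) := by
    ext v; exact quantile_le_iff κ t v a
  rw [this, volume_real_Iic]
  rfl

end kernel

/-- Almost surely `X` reveals which component was drawn, and within a component it says nothing more
about `Y`. Components of weight zero are left unconstrained. -/
theorem condDistrib_mixture {Ω T S ι : Type*} [MeasurableSpace Ω] [MeasurableSpace T]
    [MeasurableSpace S] [StandardBorelSpace S] [Nonempty S] [Fintype ι] [MeasurableSpace ι]
    [MeasurableSingletonClass ι]
    {p : ι → ℝ≥0∞} {M : ι → Measure Ω} [∀ z, IsProbabilityMeasure (M z)]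
    [IsFiniteMeasure (∑ z, p z • M z)]
    {X : Ω → T} {Y : Ω → S} (hX : Measurable X) (hY : Measurable Y)
    (hind : ∀ z, p z ≠ 0 → IndepFun X Y (M z))
    {g : T → ι} (hg : Measurable g) (hgX : ∀ z, p z ≠ 0 → ∀ᵐ x ∂M z, g (X x) = z) :
    ∀ᵐ t ∂((∑ z, p z • M z).map X),
      condDistrib Y X (∑ z, p z • M z) t = (M (g t)).map Y := by
  have hK : Measurable fun z => (M z).map Y := measurable_of_countable _
  let K : Kernel T S := (⟨fun z => (M z).map Y, hK⟩ : Kernel ι S).comap g hg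
  have : IsMarkovKernel K := ⟨fun t => Measure.isProbabilityMeasure_map hY.aemeasurable⟩
  refine condDistrib_ae_eq_of_measure_eq_compProd (κ := K) X hY.aemeasurable ?_
  have hc : ∀ z, p z ≠ 0 → (M z).map (fun x => (X x, Y x)) = (M z).map X ⊗ₘ K := by
    intro z hz
    rw [(indepFun_iff_map_prod_eq_prod_map_map hX.aemeasurable hY.aemeasurable).1 (hind z hz),
      ← Measure.compProd_const]
    refine Measure.compProd_congr ?_
    rw [Filter.EventuallyEq, ae_map_iff hX.aemeasurable ?_]
    · filter_upwards [hgX z hz] with x hx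
      simp [K, hx]
    · have : {t | (Kernel.const T ((M z).map Y)) t = K t} =
        g ⁻¹' {w | (M z).map Y = (M w).map Y} := rfl
      rw [this]
      exact hg (Set.toFinite _).measurableSet
  ext s hs
  rw [Measure.map_apply (by fun_prop) hs, Measure.compProd_apply hs,
    lintegral_map (Kernel.measurable_kernel_prodMk_left hs) hX, lintegral_finsetSum_measure,
    Measure.finsetSum_apply]
  refine Finset.sum_congr rfl fun z _ => ?_
  rcases eq_or_ne (p z) 0 with h0 | h0
  · simp [h0]
  rw [lintegral_smul_measure, Measure.smul_apply, ← Measure.map_apply (by fun_prop) hs, hc z h0,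
    Measure.compProd_apply hs, lintegral_map (Kernel.measurable_kernel_prodMk_left hs) hX]

/-! ### Marginals and redrawing one coordinate -/

namespace Copula
variable {d : ℕ}

instance (C : Copula d) (J : Finset (Fin d)) : IsProbabilityMeasure (C.marginal J) :=
  Measure.isProbabilityMeasure_map (by fun_prop)

theorem marginal_mono {C D : Copula d} {J K : Finset (Fin d)} (hJK : J ⊆ K)
    (h : C.marginal K = D.marginal K) : C.marginal J = D.marginal J := by
  have key : ∀ E : Copula d,
      E.marginal J = (E.marginal K).map (fun y (j : J) => y ⟨j, hJK j.2⟩) := fun E => by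
    rw [marginal, marginal, Measure.map_map (by fun_prop) (by fun_prop)]
    rfl
  rw [key, key, h]

/-- `condDistrib` is built from the joint law alone, so equal marginals give equality at every `t`,
not just almost everywhere. -/
theorem condCDF_congr {C D : Copula d} {j : Fin d} {L K : Finset (Fin d)} (hL : L ⊆ K)
    (hj : j ∈ K) (h : C.marginal K = D.marginal K) : C.condCDF j L = D.condCDF j L := by
  have key : ∀ E : Copula d, E.measure.map (fun x => (L.restrict x, x j))
      = (E.marginal K).map (fun y => (fun l : L => y ⟨l, hL l.2⟩, y ⟨j, hj⟩)) := fun E => by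
    have hr : Measurable fun y : K → unitInterval =>
        (fun l : L => y ⟨l, hL l.2⟩, y ⟨j, hj⟩) := by fun_prop
    rw [marginal, Measure.map_map hr (by fun_prop)]
    rfl
  have : condDistrib (fun x => x j) L.restrict C.measure
      = condDistrib (fun x => x j) L.restrict D.measure := by
    rw [condDistrib, condDistrib]
    congr 1
    rw [key, key, h]
  funext a t
  simp only [condCDF, this]

/-- The defining equation of a partial D-vine copula for the block from `i` to `k`. -/
def BlockEq (D : Copula d) (i k : Fin d)
    (A : Kernel (Finset.Ioo i k → unitInterval) (Fin 2 → unitInterval)) : Prop :=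
  ∀ u : Fin d → unitInterval,
    (D.marginal (Finset.Icc i k)).real (Set.Iic ((Finset.Icc i k).restrict u))
      = ∫ t in Set.Iic ((Finset.Ioo i k).restrict u),
          (∫ w, (A w).real
              (Set.Iic ![D.condCDF i (Finset.Ioo i k) (u i) t,
                D.condCDF k (Finset.Ioo i k) (u k) t])
            ∂(D.marginal (Finset.Ioo i k)))
          ∂(D.marginal (Finset.Ioo i k))

theorem BlockEq.congr {C D : Copula d} {i k : Fin d} (hik : i ≤ k)
    {A : Kernel (Finset.Ioo i k → unitInterval) (Fin 2 → unitInterval)}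
    (h : C.marginal (Finset.Icc i k) = D.marginal (Finset.Icc i k))
    (hC : C.BlockEq i k A) : D.BlockEq i k A := by
  have hL : Finset.Ioo i k ⊆ Finset.Icc i k := Finset.Ioo_subset_Icc_self
  intro u
  rw [← marginal_mono hL h, ← h, ← condCDF_congr hL (Finset.left_mem_Icc.2 hik) h,
    ← condCDF_congr hL (Finset.right_mem_Icc.2 hik) h]
  exact hC u

theorem marginal_Icc_Iic (D : Copula d) {i k : Fin d} (hik : i ≤ k) (u : Fin d → unitInterval) :
    D.marginal (Finset.Icc i k) (Set.Iic ((Finset.Icc i k).restrict u))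
      = D.measure.map (fun x => ((Finset.Ioo i k).restrict x, x i, x k))
        (Set.Iic ((Finset.Ioo i k).restrict u) ×ˢ (Set.Iic (u i) ×ˢ Set.Iic (u k))) := by
  rw [marginal, Measure.map_apply (by fun_prop) measurableSet_Iic, Measure.map_apply (by fun_prop)
    (measurableSet_Iic.prod (measurableSet_Iic.prod measurableSet_Iic))]
  congr 1
  ext x
  simp only [Set.mem_preimage, Set.mem_Iic, Set.mem_prod, Pi.le_def, Finset.restrict,
    Subtype.forall, Finset.mem_Icc, Finset.mem_Ioo]
  constructor
  · exact fun h => ⟨fun j hj => h j ⟨hj.1.le, hj.2.le⟩, h i ⟨le_rfl, hik⟩, h k ⟨hik, le_rfl⟩⟩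
  · rintro ⟨h1, h2, h3⟩ j ⟨hj1, hj2⟩
    rcases hj1.eq_or_lt with rfl | hj1
    · exact h2
    rcases hj2.eq_or_lt with rfl | hj2
    · exact h3
    exact h1 j ⟨hj1, hj2⟩

/-- Coordinate `k` is forgotten and drawn afresh from `κ` given `X`, a statistic that does not
involve it. The other coordinates keep their joint law; `hκ` keeps the new one uniform. -/
theorem exists_resample (D : Copula d) (k : Fin d) {T : Type*} [MeasurableSpace T]
    {X : (Fin d → unitInterval) → T} (hX : Measurable X)
    (hXk : ∀ x y, X (Function.update x k y) = X x) (κ : Kernel T unitInterval) [IsMarkovKernel κ]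
    (hκ : (D.measure.map X ⊗ₘ κ).snd = volume) :
    ∃ D' : Copula d, (∀ J : Finset (Fin d), k ∉ J → D'.marginal J = D.marginal J) ∧
      D'.measure.map (fun x => (X x, x k)) = D.measure.map X ⊗ₘ κ := by
  have hup : Measurable fun q : (Fin d → unitInterval) × unitInterval =>
      Function.update q.1 k q.2 := by
    refine measurable_pi_lambda _ fun j => ?_
    rcases eq_or_ne j k with rfl | hj
    · simpa using measurable_snd
    · simp only [Function.update_of_ne hj]; fun_prop
  set P := D.measure ⊗ₘ κ.comap X hX with hP
  set ν := P.map fun q => Function.update q.1 k q.2 with hν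
  have hinv : ∀ {S : Type _} [MeasurableSpace S] (f : (Fin d → unitInterval) → S), Measurable f →
      (∀ x y, f (Function.update x k y) = f x) → ν.map f = D.measure.map f := by
    intro S _ f hf h
    rw [hν, Measure.map_map hf hup]
    have : (f ∘ fun q : (Fin d → unitInterval) × unitInterval => Function.update q.1 k q.2)
        = f ∘ Prod.fst := by funext q; exact h q.1 q.2
    rw [this, ← Measure.map_map hf measurable_fst]
    congr 1
    exact Measure.fst_compProd _ _
  have hlast : ν.map (fun x => (X x, x k)) = D.measure.map X ⊗ₘ κ := by
    rw [hν, Measure.map_map (by fun_prop) hup]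
    have : ((fun x : Fin d → unitInterval => (X x, x k)) ∘
        fun q : (Fin d → unitInterval) × unitInterval => Function.update q.1 k q.2)
        = fun q => (X q.1, q.2) := by
      funext q; exact Prod.ext (hXk _ _) (Function.update_self _ _ _)
    rw [this]
    ext s hs
    rw [Measure.map_apply (by fun_prop) hs, hP, Measure.compProd_apply ((by fun_prop :
      Measurable fun q : (Fin d → unitInterval) × unitInterval => (X q.1, q.2)) hs),
      Measure.compProd_apply hs, lintegral_map (Kernel.measurable_kernel_prodMk_left hs) hX]
    rfl
  have hst : IsStochastic ν := by
    refine ⟨Measure.isProbabilityMeasure_map hup.aemeasurable, fun j => ?_⟩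
    rcases eq_or_ne j k with rfl | hj
    · rw [← hκ, ← hlast, Measure.snd, Measure.map_map measurable_snd (by fun_prop)]
      rfl
    · rw [hinv _ (measurable_pi_apply j) fun x y => Function.update_of_ne hj _ _]
      exact D.isStochastic.map_eval j
  refine ⟨⟨ν, hst⟩, fun J hJ => hinv _ (by fun_prop) fun x y => ?_, hlast⟩
  funext j
  exact Function.update_of_ne (fun h : (j : Fin d) = k => hJ (h ▸ j.2)) _ _

theorem marginal_congr_insert {C D : Copula d} {J L : Finset (Fin d)} {k : Fin d}
    (hJ : J ⊆ insert k L)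
    (h : C.measure.map (fun x => (L.restrict x, x k))
      = D.measure.map (fun x => (L.restrict x, x k))) :
    C.marginal J = D.marginal J := by
  classical
  let φ : (L → unitInterval) × unitInterval → J → unitInterval := fun q j =>
    if hj : (j : Fin d) = k then q.2
      else q.1 ⟨j, (Finset.mem_insert.1 (hJ j.2)).resolve_left hj⟩
  have hφ : Measurable φ := by
    refine measurable_pi_lambda _ fun j => ?_
    by_cases hj : (j : Fin d) = k
    · simp only [φ, hj, dite_true]; fun_prop
    · simp only [φ, hj, dite_false]; fun_prop
  have key : ∀ E : Copula d,
      E.marginal J = (E.measure.map (fun x => (L.restrict x, x k))).map φ := fun E => by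
    rw [marginal, Measure.map_map hφ (by fun_prop)]
    congr 1
    funext x j
    by_cases hj : (j : Fin d) = k
    · simp only [Function.comp_apply, φ, dif_pos hj]; exact congrArg x hj
    · simp [φ, hj]
  rw [key, key, h]

theorem marginal_singleton_eq (C D : Copula d) (i : Fin d) :
    C.marginal {i} = D.marginal {i} := by
  have key : ∀ E : Copula d, E.marginal {i}
      = (volume : Measure unitInterval).map (fun a _ => a) := fun E => by
    rw [← E.isStochastic.map_eval i, Measure.map_map (by fun_prop) (by fun_prop), marginal]
    congr 1
    funext x ⟨j, hj⟩
    obtain rfl := Finset.mem_singleton.1 hj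
    rfl
  rw [key, key]

theorem exists_glue_pair (C D : Copula d) {i k : Fin d} (hik : i ≠ k) :
    ∃ D' : Copula d, (∀ J : Finset (Fin d), k ∉ J → D'.marginal J = D.marginal J) ∧
      D'.marginal {i, k} = C.marginal {i, k} := by
  have hm : D.measure.map ({i} : Finset (Fin d)).restrict
      = C.measure.map ({i} : Finset (Fin d)).restrict := marginal_singleton_eq D C i
  obtain ⟨D', h1, h2⟩ := D.exists_resample k (X := ({i} : Finset (Fin d)).restrict)
    (by fun_prop)
    (fun x y => by
      funext ⟨j, hj⟩
      obtain rfl := Finset.mem_singleton.1 hj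
      exact Function.update_of_ne hik _ _)
    (condDistrib (fun x => x k) ({i} : Finset (Fin d)).restrict C.measure)
    (by
      rw [hm, compProd_map_condDistrib (measurable_pi_apply _).aemeasurable, Measure.snd,
        Measure.map_map measurable_snd (by fun_prop)]
      exact C.isStochastic.map_eval k)
  refine ⟨D', h1, marginal_congr_insert (k := k) (L := {i}) ?_ ?_⟩
  · intro j; simp; tauto
  · rw [h2, hm, compProd_map_condDistrib (measurable_pi_apply _).aemeasurable]

end Copula

/-! ### Coupling conditional laws by a partial copula -/

theorem IsStochastic.bind {T : Type*} [MeasurableSpace T] {d : ℕ} {μ : Measure T}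
    [IsProbabilityMeasure μ] {A : Kernel T (Fin d → unitInterval)}
    (hA : ∀ w, IsStochastic (A w)) : IsStochastic (A ∘ₘ μ) := by
  have : IsMarkovKernel A := ⟨fun w => (hA w).isProbabilityMeasure⟩
  refine ⟨inferInstance, fun j => ?_⟩
  ext s hs
  rw [Measure.map_apply (by fun_prop) hs, Measure.bind_apply (measurable_pi_apply j hs)
    A.aemeasurable]
  have : ∀ w, A w ((fun x => x j) ⁻¹' s) = volume s := fun w => by
    rw [← (hA w).map_eval j, Measure.map_apply (by fun_prop) hs]
  simp [this]

theorem bind_real_apply {T S : Type*} [MeasurableSpace T] [MeasurableSpace S] {μ : Measure T}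
    [IsProbabilityMeasure μ] (A : Kernel T S) [IsMarkovKernel A] {s : Set S}
    (hs : MeasurableSet s) : (A ∘ₘ μ).real s = ∫ w, (A w).real s ∂μ := by
  rw [Measure.real, Measure.bind_apply hs A.aemeasurable]
  exact (integral_toReal (A.measurable_coe hs).aemeasurable
    (.of_forall fun w => measure_lt_top _ _)).symm

section glue

variable {T : Type*} [MeasurableSpace T] (κ₁ κ₂ : Kernel T unitInterval) [IsMarkovKernel κ₁]
  [IsMarkovKernel κ₂] (m : Measure (Fin 2 → unitInterval)) [IsProbabilityMeasure m]

/-- The coupling of two kernels by a bivariate copula. -/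
def glueKernel : Kernel T (unitInterval × unitInterval) :=
  (Kernel.id ×ₖ Kernel.const T m).map
    fun q => (quantile κ₁ q.1 (q.2 0), quantile κ₂ q.1 (q.2 1))

theorem measurable_glue : Measurable fun q : T × (Fin 2 → unitInterval) =>
    (quantile κ₁ q.1 (q.2 0), quantile κ₂ q.1 (q.2 1)) :=
  ((measurable_quantile κ₁).comp (by fun_prop : Measurable fun q : T × (Fin 2 → unitInterval) =>
    (q.1, q.2 0))).prodMk
    ((measurable_quantile κ₂).comp (by fun_prop : Measurable fun q : T × (Fin 2 → unitInterval) =>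
    (q.1, q.2 1)))

theorem measurable_glue_right (t : T) : Measurable fun y : Fin 2 → unitInterval =>
    (quantile κ₁ t (y 0), quantile κ₂ t (y 1)) :=
  (measurable_glue κ₁ κ₂).comp measurable_prodMk_left

instance : IsMarkovKernel (glueKernel κ₁ κ₂ m) :=
  Kernel.IsMarkovKernel.map _ (measurable_glue κ₁ κ₂)

theorem glueKernel_apply (t : T) : glueKernel κ₁ κ₂ m t
    = m.map fun y => (quantile κ₁ t (y 0), quantile κ₂ t (y 1)) := by
  ext s hs
  rw [glueKernel, Kernel.map_apply' _ (measurable_glue κ₁ κ₂) _ hs, Kernel.id_prod_apply' _ _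
    (measurable_glue κ₁ κ₂ hs), Measure.map_apply
    (measurable_glue_right κ₁ κ₂ t) hs]
  rfl

theorem glueKernel_Iic (t : T) (a b : unitInterval) :
    glueKernel κ₁ κ₂ m t (Set.Iic a ×ˢ Set.Iic b)
      = m (Set.Iic ![distFun (κ₁ t) a, distFun (κ₂ t) b]) := by
  rw [glueKernel_apply, Measure.map_apply (measurable_glue_right κ₁ κ₂ t)
    (measurableSet_Iic.prod measurableSet_Iic)]
  congr 1
  ext y
  simp [quantile_le_iff, Pi.le_def, Fin.forall_fin_two]

variable {m}

theorem glueKernel_map_fst (hm : IsStochastic m) : (glueKernel κ₁ κ₂ m).map Prod.fst = κ₁ := by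
  ext1 t
  have h1 : Measurable (quantile κ₁ t) := (measurable_quantile κ₁).comp measurable_prodMk_left
  rw [Kernel.map_apply _ measurable_fst, glueKernel_apply, Measure.map_map measurable_fst
    (measurable_glue_right κ₁ κ₂ t), ← map_quantile κ₁ t, ← hm.map_eval 0,
    Measure.map_map h1 (by fun_prop)]
  rfl

theorem glueKernel_map_snd (hm : IsStochastic m) : (glueKernel κ₁ κ₂ m).map Prod.snd = κ₂ := by
  ext1 t
  have h1 : Measurable (quantile κ₂ t) := (measurable_quantile κ₂).comp measurable_prodMk_left
  rw [Kernel.map_apply _ measurable_snd, glueKernel_apply, Measure.map_map measurable_snd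
    (measurable_glue_right κ₁ κ₂ t), ← map_quantile κ₂ t, ← hm.map_eval 1,
    Measure.map_map h1 (by fun_prop)]
  rfl

end glue

namespace Copula
variable {d : ℕ}

/-- The conditional laws of coordinates `i` and `k` given those between are coupled by the averaged
copula `A ∘ₘ D_L`. Coupling preserves both laws, so the blocks without `i` or without `k` survive,
and with them the data entering the block equation. -/
theorem exists_glue_block (D : Copula d) {i k : Fin d} (hik : i < k)
    {A : Kernel (Finset.Ioo i k → unitInterval) (Fin 2 → unitInterval)}
    (hA : ∀ w, IsStochastic (A w)) :
    ∃ D' : Copula d, (∀ J : Finset (Fin d), k ∉ J → D'.marginal J = D.marginal J) ∧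
      D'.marginal (Finset.Ioc i k) = D.marginal (Finset.Ioc i k) ∧ D'.BlockEq i k A := by
  have : IsMarkovKernel A := ⟨fun w => (hA w).isProbabilityMeasure⟩
  obtain ⟨κ₁, hκ₁⟩ : ∃ κ, κ = condDistrib (fun x => x i) (Finset.Ioo i k).restrict D.measure :=
    ⟨_, rfl⟩
  obtain ⟨κ₂, hκ₂⟩ : ∃ κ, κ = condDistrib (fun x => x k) (Finset.Ioo i k).restrict D.measure :=
    ⟨_, rfl⟩
  have : IsMarkovKernel κ₁ := hκ₁ ▸ inferInstance
  have : IsMarkovKernel κ₂ := hκ₂ ▸ inferInstance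
  have hm : IsStochastic (A ∘ₘ D.marginal (Finset.Ioo i k)) := IsStochastic.bind hA
  set m := A ∘ₘ D.marginal (Finset.Ioo i k)
  have := hm.isProbabilityMeasure
  set R := D.marginal (Finset.Ioo i k) ⊗ₘ glueKernel κ₁ κ₂ m with hR
  have hR1 : R.map (fun q => (q.1, q.2.1))
      = D.measure.map (fun x => ((Finset.Ioo i k).restrict x, x i)) := by
    rw [← compProd_map_condDistrib (measurable_pi_apply _).aemeasurable, ← hκ₁,
      ← glueKernel_map_fst κ₁ κ₂ hm,
      Measure.compProd_map measurable_fst]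
    rfl
  have hR2 : R.map (fun q => (q.1, q.2.2))
      = D.measure.map (fun x => ((Finset.Ioo i k).restrict x, x k)) := by
    rw [← compProd_map_condDistrib (measurable_pi_apply _).aemeasurable, ← hκ₂,
      ← glueKernel_map_snd κ₁ κ₂ hm,
      Measure.compProd_map measurable_snd]
    rfl
  -- Regrouped so that coordinate `k` stands alone: it is redrawn from its conditional law, under
  -- `R`, given the rest of the block.
  set R' := R.map (fun q => ((q.1, q.2.1), q.2.2)) with hR'
  have : IsProbabilityMeasure R' := Measure.isProbabilityMeasure_map (by fun_prop)
  have hfst : D.measure.map (fun x => ((Finset.Ioo i k).restrict x, x i)) = R'.fst := by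
    rw [← hR1, hR', Measure.fst, Measure.map_map measurable_fst (by fun_prop)]
    rfl
  obtain ⟨D', h1, h2⟩ := D.exists_resample k (X := fun x => ((Finset.Ioo i k).restrict x, x i))
    (by fun_prop)
    (fun x y => by
      refine Prod.ext ?_ (Function.update_of_ne hik.ne _ _)
      funext ⟨j, hj⟩
      exact Function.update_of_ne (Finset.mem_Ioo.1 hj).2.ne _ _)
    R'.condKernel
    (by
      rw [hfst, R'.disintegrate, hR', Measure.snd, Measure.map_map measurable_snd (by fun_prop)]
      rw [← D.isStochastic.map_eval k]
      have := congrArg (fun ρ => ρ.map Prod.snd) hR2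
      rw [Measure.map_map measurable_snd (by fun_prop),
        Measure.map_map measurable_snd (by fun_prop)] at this
      exact this)
  rw [hfst, R'.disintegrate] at h2
  have hk : D'.measure.map (fun x => ((Finset.Ioo i k).restrict x, x k))
      = D.measure.map (fun x => ((Finset.Ioo i k).restrict x, x k)) := by
    rw [← hR2]
    have := congrArg (fun ρ => ρ.map fun q => (q.1.1, q.2)) h2
    rw [hR', Measure.map_map (by fun_prop) (by fun_prop),
      Measure.map_map (by fun_prop) (by fun_prop)] at this
    exact this
  have hIoc : D'.marginal (Finset.Ioc i k) = D.marginal (Finset.Ioc i k) := by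
    refine marginal_congr_insert (fun j hj => ?_) hk
    rw [Finset.mem_Ioc] at hj
    rw [Finset.mem_insert, Finset.mem_Ioo]
    rcases hj.2.eq_or_lt with h | h
    · exact Or.inl h
    · exact Or.inr ⟨hj.1, h⟩
  refine ⟨D', h1, hIoc, fun u => ?_⟩
  have hLm : D'.marginal (Finset.Ioo i k) = D.marginal (Finset.Ioo i k) := h1 _ (by simp)
  rw [hLm, condCDF_congr (K := Finset.Ico i k) (j := i) Finset.Ioo_subset_Ico_self
      (by simpa using hik) (h1 _ (by simp)), condCDF_congr (K := Finset.Ioc i k) (j := k)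
      Finset.Ioo_subset_Ioc_self (by simpa using hik) hIoc, Measure.real,
      marginal_Icc_Iic _ hik.le]
  have hR3 : D'.measure.map (fun x => ((Finset.Ioo i k).restrict x, x i, x k)) = R := by
    have := congrArg (fun ρ => ρ.map fun q => (q.1.1, q.1.2, q.2)) h2
    rw [hR', Measure.map_map (by fun_prop) (by fun_prop),
      Measure.map_map (by fun_prop) (by fun_prop)] at this
    refine Eq.trans ?_ (this.trans ?_)
    · rfl
    · exact Measure.map_id
  rw [hR3, hR, Measure.compProd_apply_prod measurableSet_Iic
    (measurableSet_Iic.prod measurableSet_Iic)]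
  simp_rw [← bind_real_apply A measurableSet_Iic]
  rw [← integral_toReal (Kernel.measurable_coe _
    (measurableSet_Iic.prod measurableSet_Iic)).aemeasurable
    (.of_forall fun w => measure_lt_top _ _)]
  refine setIntegral_congr_fun measurableSet_Iic fun t _ => ?_
  simp only [glueKernel_Iic]
  subst hκ₁ hκ₂
  rfl

end Copula

/-! ### Sklar's theorem and existence of partial D-vine copulas -/

theorem isStochastic_pi_volume (d : ℕ) :
    IsStochastic (volume : Measure (Fin d → unitInterval)) :=
  ⟨inferInstance, fun i => (measurePreserving_eval (fun _ => volume) i).map_eq⟩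

theorem measurable_vec₂ {α : Type*} [MeasurableSpace α] {f g : α → unitInterval}
    (hf : Measurable f) (hg : Measurable g) : Measurable fun a => ![f a, g a] := by
  refine measurable_pi_lambda _ fun j => ?_
  fin_cases j
  · exact hf
  · exact hg

/-- Sklar's theorem for continuous margins. -/
theorem sklar_of_continuous {ρ : Measure (Fin 2 → unitInterval)} [IsProbabilityMeasure ρ]
    {m₁ m₂ : Measure unitInterval} [IsProbabilityMeasure m₁] [IsProbabilityMeasure m₂]
    (h₁ : ρ.map (fun y => y 0) = m₁) (h₂ : ρ.map (fun y => y 1) = m₂)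
    (hc₁ : Continuous (distFun m₁)) (hz₁ : distFun m₁ 0 = 0)
    (hc₂ : Continuous (distFun m₂)) (hz₂ : distFun m₂ 0 = 0) :
    IsStochastic (ρ.map fun y => ![distFun m₁ (y 0), distFun m₂ (y 1)]) ∧
      ∀ a b, ρ.real (Set.Iic ![a, b])
        = (ρ.map fun y => ![distFun m₁ (y 0), distFun m₂ (y 1)]).real
          (Set.Iic ![distFun m₁ a, distFun m₂ b]) := by
  have hp : ∀ j, Measurable fun y : Fin 2 → unitInterval => y j := measurable_pi_apply
  have hm₁ := hc₁.measurable
  have hm₂ := hc₂.measurable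
  have hΦ : Measurable fun y : Fin 2 → unitInterval => ![distFun m₁ (y 0), distFun m₂ (y 1)] :=
    measurable_vec₂ (by fun_prop) (by fun_prop)
  refine ⟨⟨Measure.isProbabilityMeasure_map hΦ.aemeasurable, fun j => ?_⟩, fun a b => ?_⟩
  · rw [Measure.map_map (measurable_pi_apply j) hΦ]
    fin_cases j
    · rw [← map_distFun hc₁ hz₁]
      conv_rhs => arg 2; rw [← h₁]
      rw [Measure.map_map hm₁ (hp 0)]
      rfl
    · rw [← map_distFun hc₂ hz₂]
      conv_rhs => arg 2; rw [← h₂]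
      rw [Measure.map_map hm₂ (hp 1)]
      rfl
  · rw [map_measureReal_apply hΦ measurableSet_Iic]
    refine measureReal_congr ?_
    have a₁ : ∀ᵐ y ∂ρ.map (fun y => y 0), distFun m₁ y ≤ distFun m₁ a ↔ y ≤ a := by
      rw [h₁]; exact distFun_le_iff_ae hc₁ hz₁ a
    have a₂ : ∀ᵐ y ∂ρ.map (fun y => y 1), distFun m₂ y ≤ distFun m₂ b ↔ y ≤ b := by
      rw [h₂]; exact distFun_le_iff_ae hc₂ hz₂ b
    filter_upwards [ae_of_ae_map (hp 0).aemeasurable a₁,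
      ae_of_ae_map (hp 1).aemeasurable a₂] with y hy₁ hy₂
    refine propext ?_
    change y ≤ ![a, b] ↔ ![distFun m₁ (y 0), distFun m₂ (y 1)] ≤ ![distFun m₁ a, distFun m₂ b]
    simp [Pi.le_def, Fin.forall_fin_two, hy₁, hy₂]

namespace Copula
variable {d : ℕ}

/-- The average over `t` is the mass of a point under a uniform marginal. -/
theorem ae_condCDF_zero (C : Copula d) (j : Fin d) (L : Finset (Fin d)) :
    ∀ᵐ t ∂C.marginal L, C.condCDF j L 0 t = 0 := by
  have h : ∫⁻ t, condDistrib (fun x => x j) L.restrict C.measure t (Set.Iic 0) ∂C.marginal L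
      = 0 := by
    rw [← setLIntegral_univ, marginal, ← Measure.compProd_apply_prod MeasurableSet.univ
      measurableSet_Iic, compProd_map_condDistrib (measurable_pi_apply _).aemeasurable,
      Measure.map_apply (by fun_prop) (MeasurableSet.univ.prod measurableSet_Iic)]
    have h0 : C.measure.map (fun x => x j) (Set.Iic 0) = 0 := by
      rw [C.isStochastic.map_eval j]; simp
    rw [Measure.map_apply (by fun_prop) measurableSet_Iic] at h0
    exact measure_mono_null (fun x hx => hx.2) h0
  rw [lintegral_eq_zero_iff (Kernel.measurable_coe _ measurableSet_Iic)] at h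
  filter_upwards [h] with t ht
  ext
  simp only [condCDF, Measure.real, Set.Icc.coe_zero]
  rw [ht]; simp

theorem condPair_map_ae (C : Copula d) (i k : Fin d) (L : Finset (Fin d)) :
    ∀ᵐ t ∂C.marginal L,
      (C.condPair i k L t).map (fun y => y 0) = condDistrib (fun x => x i) L.restrict C.measure t ∧
      (C.condPair i k L t).map (fun y => y 1)
        = condDistrib (fun x => x k) L.restrict C.measure t := by
  have hm : Measurable fun x : Fin d → unitInterval => ![x i, x k] :=
    measurable_vec₂ (measurable_pi_apply i) (measurable_pi_apply k)
  have h0 := condDistrib_comp (mβ := MeasurableSpace.pi) (μ := C.measure)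
    (L.restrict (π := fun _ => unitInterval)) hm.aemeasurable
    (measurable_pi_apply (0 : Fin 2))
  have h1 := condDistrib_comp (mβ := MeasurableSpace.pi) (μ := C.measure)
    (L.restrict (π := fun _ => unitInterval)) hm.aemeasurable
    (measurable_pi_apply (1 : Fin 2))
  filter_upwards [h0, h1] with t ht0 ht1
  rw [Kernel.map_apply _ (measurable_pi_apply _)] at ht0 ht1
  exact ⟨ht0.symm, ht1.symm⟩

/-- Each conditional pair law is pushed forward by its own two distribution functions; almost surely
these are continuous and vanish at 0, so Sklar's theorem applies fibrewise. -/
theorem exists_isCondCopula {C : Copula d} (hC : C.HasContinuousCondCDFs) {i k : Fin d}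
    {L : Finset (Fin d)} (hL : L.Nonempty) (hLd : L.card + 2 ≤ d) (hi : i ∉ L) (hk : k ∉ L) :
    ∃ A, C.IsCondCopula i k L A := by
  classical
  obtain ⟨κ₁, hκ₁⟩ : ∃ κ, κ = condDistrib (fun x => x i) L.restrict C.measure := ⟨_, rfl⟩
  obtain ⟨κ₂, hκ₂⟩ : ∃ κ, κ = condDistrib (fun x => x k) L.restrict C.measure := ⟨_, rfl⟩
  have : IsMarkovKernel κ₁ := hκ₁ ▸ inferInstance
  have : IsMarkovKernel κ₂ := hκ₂ ▸ inferInstance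
  have : IsMarkovKernel (C.condPair i k L) := by unfold condPair; infer_instance
  let Φ : (L → unitInterval) × (Fin 2 → unitInterval) → Fin 2 → unitInterval :=
    fun q => ![distFun (κ₁ q.1) (q.2 0), distFun (κ₂ q.1) (q.2 1)]
  have hΦ : Measurable Φ := measurable_vec₂
    ((measurable_distFun_kernel κ₁).comp (by fun_prop :
      Measurable fun q : (L → unitInterval) × (Fin 2 → unitInterval) => (q.1, q.2 0)))
    ((measurable_distFun_kernel κ₂).comp (by fun_prop :
      Measurable fun q : (L → unitInterval) × (Fin 2 → unitInterval) => (q.1, q.2 1)))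
  have hΦ' : ∀ t, Measurable fun y => Φ (t, y) := fun t => hΦ.comp measurable_prodMk_left
  let B : Kernel (L → unitInterval) (Fin 2 → unitInterval) :=
    (Kernel.id ×ₖ C.condPair i k L).map Φ
  have hB : ∀ t, B t = (C.condPair i k L t).map fun y => Φ (t, y) := fun t => by
    ext s hs
    rw [Kernel.map_apply' _ hΦ _ hs, Kernel.id_prod_apply' _ _ (hΦ hs),
      Measure.map_apply (hΦ' t) hs]
    rfl
  have key : ∀ᵐ t ∂C.marginal L, IsStochastic (B t) ∧ ∀ a b : unitInterval,
      (C.condPair i k L t).real (Set.Iic ![a, b])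
        = (B t).real (Set.Iic ![C.condCDF i L a t, C.condCDF k L b t]) := by
    filter_upwards [C.condPair_map_ae i k L, hC L i hL hLd hi, hC L k hL hLd hk,
      C.ae_condCDF_zero i L, C.ae_condCDF_zero k L] with t ht hc₁ hc₂ hz₁ hz₂
    rw [← hκ₁, ← hκ₂] at ht
    have hF₁ : ∀ a, C.condCDF i L a t = distFun (κ₁ t) a := by subst hκ₁; exact fun a => rfl
    have hF₂ : ∀ a, C.condCDF k L a t = distFun (κ₂ t) a := by subst hκ₂; exact fun a => rfl
    simp only [hF₁, hF₂] at hc₁ hc₂ hz₁ hz₂ ⊢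
    rw [hB]
    exact sklar_of_continuous ht.1 ht.2 hc₁ hz₁ hc₂ hz₂
  -- `IsCondCopula` asks for a copula at every `w`, so the independence copula is used on an
  -- exceptional null set.
  obtain ⟨N, hN, hNm, hN0⟩ := exists_measurable_superset_of_null key
  refine ⟨Kernel.piecewise hNm (Kernel.const _ volume) B, fun w => ?_, ?_⟩
  · rw [Kernel.piecewise_apply]
    split_ifs with hw
    · exact isStochastic_pi_volume 2
    · exact (not_not.1 fun h => hw (hN h) : w ∈ _).1
  · filter_upwards [key, measure_eq_zero_iff_ae_notMem.1 hN0] with w hw hwN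
    rw [Kernel.piecewise_apply, if_neg hwN]
    exact hw.2

/-- The rank `k * d + (d - i)` orders pairs by increasing `k`, then decreasing `i`. Solving the
equation for `(i, k)` redraws only coordinate `k` and preserves the marginal on `Ioc i k`. Earlier
pairs either avoid `k` or lie inside `Ioc i k`, so their equations persist. -/
theorem exists_pairs_blocks (C : Copula d)
    (A : ∀ i k : Fin d, Kernel (Finset.Ioo i k → unitInterval) (Fin 2 → unitInterval))
    (hA : ∀ i k : Fin d, (i : ℕ) + 2 ≤ k → ∀ w, IsStochastic (A i k w)) (n : ℕ) :
    ∃ D : Copula d,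
      (∀ i k : Fin d, (k : ℕ) * d + (d - i) < n → (i : ℕ) + 1 = k →
        D.marginal {i, k} = C.marginal {i, k}) ∧
      (∀ i k : Fin d, (k : ℕ) * d + (d - i) < n → (i : ℕ) + 2 ≤ k → D.BlockEq i k (A i k)) := by
  induction n with
  | zero => exact ⟨C, fun i k h => absurd h (Nat.not_lt_zero _), fun i k h =>
      absurd h (Nat.not_lt_zero _)⟩
  | succ n ih =>
    obtain ⟨D, hD₁, hD₂⟩ := ih
    have rank : ∀ i k i' k' : Fin d, (k : ℕ) * d + (d - i) = n →
        (k' : ℕ) * d + (d - i') < n + 1 →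
        (i' = i ∧ k' = k) ∨ ((k' : ℕ) * d + (d - i') < n ∧ (k' < k ∨ k' = k ∧ i < i')) := by
      intro i k i' k' h h'
      have hi := i.2
      have hi' := i'.2
      rcases lt_trichotomy k' k with hk | hk | hk
      · refine Or.inr ⟨?_, Or.inl hk⟩
        have : ((k' : ℕ) + 1) * d ≤ k * d := Nat.mul_le_mul_right _ hk
        rw [add_mul] at this
        omega
      · subst hk
        rcases lt_trichotomy i' i with hii | hii | hii
        · have : (i' : ℕ) < i := hii
          omega
        · exact Or.inl ⟨hii, rfl⟩
        · have : (i : ℕ) < i' := hii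
          exact Or.inr ⟨by omega, Or.inr ⟨rfl, hii⟩⟩
      · have : ((k : ℕ) + 1) * d ≤ k' * d := Nat.mul_le_mul_right _ hk
        rw [add_mul] at this
        omega
    by_cases hex : ∃ i k : Fin d, (k : ℕ) * d + (d - i) = n ∧ (i : ℕ) + 1 ≤ k
    · obtain ⟨i, k, hn, hik⟩ := hex
      have main : ∃ D' : Copula d,
          (∀ J : Finset (Fin d), k ∉ J → D'.marginal J = D.marginal J) ∧
          ((i : ℕ) + 2 ≤ k → D'.marginal (Finset.Ioc i k) = D.marginal (Finset.Ioc i k)) ∧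
          ((i : ℕ) + 1 = k → D'.marginal {i, k} = C.marginal {i, k}) ∧
          ((i : ℕ) + 2 ≤ k → D'.BlockEq i k (A i k)) := by
        rcases hik.eq_or_lt with h | h
        · obtain ⟨D', h1, h2⟩ := exists_glue_pair C D (i := i) (k := k)
            (fun h' => by rw [h'] at h; omega)
          exact ⟨D', h1, fun h' => by omega, fun _ => h2, fun h' => by omega⟩
        · obtain ⟨D', h1, h2, h3⟩ := D.exists_glue_block (i := i) (k := k)
            (Fin.lt_def.2 (by omega)) (hA i k h)
          exact ⟨D', h1, fun _ => h2, fun h' => by omega, fun _ => h3⟩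
      obtain ⟨D', h1, h2, h3, h4⟩ := main
      refine ⟨D', fun i' k' hr hik' => ?_, fun i' k' hr hik' => ?_⟩
      · rcases rank i k i' k' hn hr with ⟨rfl, rfl⟩ | ⟨hr, hlt | ⟨rfl, hlt⟩⟩
        · exact h3 hik'
        · rw [← hD₁ i' k' hr hik', h1]
          have : (k' : ℕ) < k := hlt
          simp only [Finset.mem_insert, Finset.mem_singleton, not_or]
          constructor <;> rintro rfl <;> omega
        · have : (i : ℕ) < i' := hlt
          rw [← hD₁ i' k' hr hik']
          refine marginal_mono ?_ (h2 (by omega))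
          intro j hj
          simp only [Finset.mem_insert, Finset.mem_singleton] at hj
          rw [Finset.mem_Ioc]
          rcases hj with rfl | rfl
          · exact ⟨hlt, Fin.le_def.2 (by omega)⟩
          · exact ⟨Fin.lt_def.2 (by omega), le_rfl⟩
      · have hle : i' ≤ k' := Fin.le_def.2 (by omega)
        rcases rank i k i' k' hn hr with ⟨rfl, rfl⟩ | ⟨hr, hlt | ⟨rfl, hlt⟩⟩
        · exact h4 hik'
        · refine (hD₂ i' k' hr hik').congr hle (h1 _ ?_).symm
          simp [hlt]
        · have : (i : ℕ) < i' := hlt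
          refine (hD₂ i' k' hr hik').congr hle (marginal_mono ?_ (h2 (by omega))).symm
          intro j hj
          rw [Finset.mem_Icc] at hj
          exact Finset.mem_Ioc.2 ⟨hlt.trans_le hj.1, hj.2⟩
    · refine ⟨D, fun i k hr hik => hD₁ i k ?_ hik, fun i k hr hik => hD₂ i k ?_ hik⟩
      · refine lt_of_le_of_ne (Nat.lt_succ_iff.1 hr) fun h => hex ⟨i, k, h, by omega⟩
      · refine lt_of_le_of_ne (Nat.lt_succ_iff.1 hr) fun h => hex ⟨i, k, h, by omega⟩

theorem card_Ioo_add_two_le {i k : Fin d} (hik : (i : ℕ) + 2 ≤ k) :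
    (Finset.Ioo i k).card + 2 ≤ d := by
  have := k.2
  rw [Fin.card_Ioo]; omega

theorem nonempty_Ioo {i k : Fin d} (hik : (i : ℕ) + 2 ≤ k) : (Finset.Ioo i k).Nonempty := by
  have := k.2
  exact ⟨⟨i + 1, by omega⟩,
    Finset.mem_Ioo.2 ⟨Fin.lt_def.2 (by simp), Fin.lt_def.2 (by simp; omega)⟩⟩

theorem exists_isPartialDVine {C : Copula d} (hC : C.HasContinuousCondCDFs) :
    ∃ D, C.IsPartialDVine D := by
  have hex : ∀ i k : Fin d, ∃ A, (i : ℕ) + 2 ≤ k → C.IsCondCopula i k (Finset.Ioo i k) A := by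
    intro i k
    by_cases hik : (i : ℕ) + 2 ≤ k
    · obtain ⟨A, hA⟩ := exists_isCondCopula hC (nonempty_Ioo hik) (card_Ioo_add_two_le hik)
        (i := i) (k := k) (by simp) (by simp)
      exact ⟨A, fun _ => hA⟩
    · exact ⟨Kernel.const _ volume, fun h => absurd h hik⟩
  choose A hA using hex
  -- The bound exceeds every rank, since `k * d < d * d` and `d - i ≤ d`.
  obtain ⟨D, h1, h2⟩ := exists_pairs_blocks C A (fun i k hik => (hA i k hik).isStochastic)
    (d * d + d)
  have hr : ∀ i k : Fin d, (k : ℕ) * d + (d - i) < d * d + d := fun i k => by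
    have : (k : ℕ) * d < d * d := Nat.mul_lt_mul_of_pos_right k.2 (by have := k.2; omega)
    omega
  exact ⟨D, fun i k hik => h1 i k (hr i k) hik, fun i k hik =>
    ⟨A i k, hA i k hik, h2 i k (hr i k) hik⟩⟩

end Copula

theorem exists_isPartialDVineMap (d : ℕ) :
    ∃ ψ : ContCopula d → Copula d, IsPartialDVineMap ψ :=
  ⟨fun C => (Copula.exists_isPartialDVine C.2).choose,
    fun C => (Copula.exists_isPartialDVine C.2).choose_spec⟩

/-! ### Cutting the unit interval; independence under product measures -/

theorem exists_measure_Iic_eq (μ : Measure unitInterval) [IsFiniteMeasure μ]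
    [NullSingletonClass μ] {q : ℝ≥0∞} (hq : q ≤ μ Set.univ) : ∃ x, μ (Set.Iic x) = q := by
  have hq' : q ≠ ∞ := (hq.trans_lt (measure_lt_top _ _)).ne
  have h := intermediate_value_Icc (zero_le_one : (0 : unitInterval) ≤ 1)
    (continuous_measureReal_Iic μ).continuousOn
  have h1 : Set.Iic (1 : unitInterval) = Set.univ :=
    Set.eq_univ_of_forall fun x => unitInterval.le_one'
  have h0 : Set.Iic (0 : unitInterval) = {0} := Set.Iic_bot
  obtain ⟨x, -, hx⟩ := h (show q.toReal ∈ _ from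
    ⟨by simp [h0, Measure.real], by rw [h1]; exact ENNReal.toReal_mono (measure_ne_top _ _) hq⟩)
  exact ⟨x, (ENNReal.toReal_eq_toReal_iff' (measure_ne_top _ _) hq').1 hx⟩

/-- An initial interval of the required mass is cut off for one index after another; the last index
receives what remains. -/
theorem exists_measurable_coding {ι : Type*} [MeasurableSpace ι] (s : Finset ι) (hs : s.Nonempty)
    (q : ι → ℝ≥0∞) (μ : Measure unitInterval) [IsFiniteMeasure μ]
    [NullSingletonClass μ] (hq : ∑ z ∈ s, q z = μ Set.univ) :
    ∃ f : unitInterval → ι, Measurable f ∧ (∀ x, f x ∈ s) ∧ ∀ z ∈ s, μ (f ⁻¹' {z}) = q z := by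
  classical
  induction hs using Finset.Nonempty.cons_induction generalizing μ with
  | singleton a =>
    refine ⟨fun _ => a, measurable_const, by simp, fun z hz => ?_⟩
    obtain rfl := Finset.mem_singleton.1 hz
    simpa using hq.symm
  | cons a s ha hs ih =>
    rw [Finset.sum_cons] at hq
    obtain ⟨x, hx⟩ := exists_measure_Iic_eq μ (q := q a) (hq ▸ le_self_add)
    have hfin : q a ≠ ∞ := hx ▸ measure_ne_top _ _
    obtain ⟨f, hf, hfs, hfq⟩ := ih (μ.restrict (Set.Ioi x)) (by
      have h := measure_add_measure_compl (μ := μ) (s := Set.Iic x) measurableSet_Iic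
      rw [hx, ← hq, Set.compl_Iic] at h
      rw [Measure.restrict_apply_univ]
      exact ((ENNReal.add_right_inj hfin).1 h).symm)
    refine ⟨fun y => if y ≤ x then a else f y, Measurable.ite measurableSet_Iic measurable_const hf,
      fun y => ?_, fun z hz => ?_⟩
    · dsimp only
      split_ifs
      · exact Finset.mem_cons_self _ _
      · exact Finset.mem_cons_of_mem (hfs y)
    · rcases Finset.mem_cons.1 hz with rfl | hz
      · rw [← hx]
        congr 1
        ext y
        simp only [Set.mem_preimage, Set.mem_singleton_iff, Set.mem_Iic]
        split_ifs with h
        · simp [h]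
        · simp only [h, iff_false]
          exact fun h' => ha (h' ▸ hfs y)
      · have hza : a ≠ z := fun h => ha (h ▸ hz)
        rw [← hfq z hz, Measure.restrict_apply' measurableSet_Ioi]
        congr 1
        ext y
        simp only [Set.mem_preimage, Set.mem_singleton_iff, Set.mem_inter_iff, Set.mem_Ioi]
        split_ifs with h
        · simp [hza, h]
        · simp [not_le.1 h]

theorem exists_grid {δ : ℝ} (hδ : 0 < δ) : ∃ (m : ℕ) (c : unitInterval → Fin m), Measurable c ∧
    Monotone c ∧ ∀ a, (volume : Measure unitInterval) (c ⁻¹' {a}) ≤ ENNReal.ofReal δ := by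
  obtain ⟨N, hN⟩ := exists_nat_gt (1 / δ)
  have hN0 : (0 : ℝ) < N := (by positivity : (0 : ℝ) < 1 / δ).trans hN
  have hlt : ∀ x : unitInterval, ⌊(N : ℝ) * x⌋₊ < N + 1 := fun x => by
    rw [Nat.lt_succ_iff]
    refine Nat.floor_le_of_le ?_
    have := x.2.2
    nlinarith
  have hmono : Monotone fun x : unitInterval => (⟨⌊(N : ℝ) * x⌋₊, hlt x⟩ : Fin (N + 1)) :=
    fun x y hxy => Fin.mk_le_mk.2 (Nat.floor_le_floor
      (mul_le_mul_of_nonneg_left (Subtype.coe_le_coe.2 hxy) hN0.le))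
  -- There are `N + 1` cells because the point 1 alone has floor `N`.
  refine ⟨N + 1, _, hmono.measurable, hmono, fun a => ?_⟩
  rw [unitInterval.volume_apply]
  have hsub : (Subtype.val '' ((fun x : unitInterval =>
      (⟨⌊(N : ℝ) * x⌋₊, hlt x⟩ : Fin (N + 1))) ⁻¹' {a})) ⊆ Set.Icc ((a : ℝ) / N) ((a + 1) / N) := by
    rintro _ ⟨x, hx, rfl⟩
    have hx' : ⌊(N : ℝ) * x⌋₊ = (a : ℕ) := congrArg Fin.val hx
    have h0 : 0 ≤ (N : ℝ) * x := mul_nonneg hN0.le x.2.1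
    have h1 := Nat.floor_le h0
    have h2 := Nat.lt_floor_add_one ((N : ℝ) * x)
    rw [hx'] at h1 h2
    rw [Set.mem_Icc, div_le_iff₀ hN0, le_div_iff₀ hN0]
    constructor <;> linarith
  refine (measure_mono hsub).trans ?_
  rw [Real.volume_Icc]
  refine ENNReal.ofReal_le_ofReal ?_
  rw [← sub_div, add_sub_cancel_left, div_le_iff₀ hN0]
  rw [div_lt_iff₀ hδ] at hN
  linarith

theorem pi_cond_absolutelyContinuous {d : ℕ} (S : Fin d → Set unitInterval) :
    Measure.pi (fun j => (volume : Measure unitInterval)[|S j]) ≪ volume := by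
  have h : Measure.pi (fun j => (volume : Measure unitInterval)[|S j])
      = (∏ j, (volume (S j))⁻¹) • (volume : Measure (Fin d → unitInterval)).restrict
        (Set.univ.pi S) := by
    refine Measure.pi_eq fun s hs => ?_
    rw [Measure.smul_apply, Measure.restrict_apply (MeasurableSet.univ_pi hs),
      ← Set.pi_inter_distrib,
      volume_pi_pi, smul_eq_mul, ← Finset.prod_mul_distrib]
    refine Finset.prod_congr rfl fun j _ => ?_
    rw [cond_apply' (hs j), Set.inter_comm]
  rw [h]
  exact (Measure.smul_absolutelyContinuous).trans Measure.restrict_le_self.absolutelyContinuous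

theorem indepFun_restrict_pi {d : ℕ} (ν : Fin d → Measure unitInterval)
    [∀ j, IsProbabilityMeasure (ν j)] {S T : Finset (Fin d)} (hST : Disjoint S T) :
    IndepFun S.restrict T.restrict (Measure.pi ν) := by
  have h := iIndepFun_pi (μ := ν) (X := fun _ x => x) (fun _ => aemeasurable_id)
  exact h.indepFun_finset S T hST fun j => measurable_pi_apply j

theorem indepFun_pi_eval {d : ℕ} (ν : Fin d → Measure unitInterval)
    [∀ j, IsProbabilityMeasure (ν j)] {i k : Fin d} (hik : i ≠ k) :
    IndepFun (fun x : Fin d → unitInterval => x i) (fun x => x k) (Measure.pi ν) :=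
  (iIndepFun_pi (μ := ν) (X := fun _ x => x) (fun _ => aemeasurable_id)).indepFun hik

theorem indepFun_restrict_pi_eval {d : ℕ} (ν : Fin d → Measure unitInterval)
    [∀ j, IsProbabilityMeasure (ν j)] {L : Finset (Fin d)} {j : Fin d} (hj : j ∉ L) :
    IndepFun L.restrict (fun x : Fin d → unitInterval => x j) (Measure.pi ν) := by
  have h := indepFun_restrict_pi ν (S := L) (T := {j}) (by simpa using hj)
  let ψ : (({j} : Finset (Fin d)) → unitInterval) → unitInterval := fun y => y ⟨j, by simp⟩
  have hψ : Measurable ψ := by fun_prop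
  exact h.comp measurable_id hψ

theorem indepFun_restrict_pi_pair {d : ℕ} (ν : Fin d → Measure unitInterval)
    [∀ j, IsProbabilityMeasure (ν j)] {L : Finset (Fin d)} {i k : Fin d} (hi : i ∉ L)
    (hk : k ∉ L) :
    IndepFun L.restrict (fun x : Fin d → unitInterval => ![x i, x k]) (Measure.pi ν) := by
  have h := indepFun_restrict_pi ν (S := L) (T := {i, k}) (by simp [hi, hk])
  let ψ : (({i, k} : Finset (Fin d)) → unitInterval) → Fin 2 → unitInterval :=
    fun y => ![y ⟨i, by simp⟩, y ⟨k, by simp⟩]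
  have hψ : Measurable ψ := measurable_vec₂ (by fun_prop) (by fun_prop)
  exact h.comp measurable_id hψ

namespace Copula
variable {d : ℕ}

/-- Absolute continuity with respect to a product passes to almost every conditional law, which
therefore has no atoms. -/
theorem hasContinuousCondCDFs_of_absolutelyContinuous {C : Copula d} (hC : C.measure ≪ volume) :
    C.HasContinuousCondCDFs := by
  intro L j _ _ hj
  have h := hC.map (f := fun x : Fin d → unitInterval => (L.restrict x, x j)) (by fun_prop)
  rw [volume_pi, (indepFun_iff_map_prod_eq_prod_map_map (by fun_prop)
      (measurable_pi_apply j).aemeasurable).1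
    (indepFun_restrict_pi_eval (fun _ => volume) hj), ← Measure.compProd_const,
    ← compProd_map_condDistrib (measurable_pi_apply _).aemeasurable] at h
  filter_upwards [h.kernel_of_compProd] with t ht
  have hm : (Measure.pi fun _ : Fin d => (volume : Measure unitInterval)).map (fun x => x j)
      = volume := (measurePreserving_eval (fun _ => volume) j).map_eq
  rw [Kernel.const_apply, hm] at ht
  have : NullSingletonClass (condDistrib (fun x => x j) L.restrict C.measure t) :=
    ⟨fun x => ht (measure_singleton x)⟩
  exact (continuous_measureReal_Iic _).subtype_mk _

/-- Both copulas at `u` differ from the common mass of the cells up to that of `u` by at most the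
mass of `d` slabs, one per coordinate, each of mass at most `δ`. -/
theorem dist_le_of_grid {C E : Copula d} {m : ℕ} {c : unitInterval → Fin m} (hc : Measurable c)
    (hmono : Monotone c) {δ : ℝ} (hδ : 0 ≤ δ)
    (hcδ : ∀ a, (volume : Measure unitInterval) (c ⁻¹' {a}) ≤ ENNReal.ofReal δ)
    (h : ∀ z, E.measure ((fun x j => c (x j)) ⁻¹' {z}) = C.measure ((fun x j => c (x j)) ⁻¹' {z})) :
    dist E C ≤ d * δ := by
  have hg : Measurable fun (x : Fin d → unitInterval) j => c (x j) := by fun_prop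
  have hmap : E.measure.map (fun x j => c (x j)) = C.measure.map (fun x j => c (x j)) := by
    refine Measure.ext_of_singleton fun z => ?_
    rw [Measure.map_apply hg (measurableSet_singleton z),
      Measure.map_apply hg (measurableSet_singleton z), h]
  have key : ∀ (D : Copula d) (u : Fin d → unitInterval),
      D u ≤ (D.measure.map fun x j => c (x j)).real (Set.Iic fun j => c (u j)) ∧
      (D.measure.map fun x j => c (x j)).real (Set.Iic fun j => c (u j)) ≤ D u + d * δ := by
    intro D u
    rw [map_measureReal_apply hg (Set.toFinite _).measurableSet]
    refine ⟨measureReal_mono fun x hx j => hmono (hx j), ?_⟩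
    have hsub : (fun (x : Fin d → unitInterval) j => c (x j)) ⁻¹' (Set.Iic fun j => c (u j))
        ⊆ Set.Iic u ∪ ⋃ j ∈ Finset.univ, (fun x => x j) ⁻¹' (c ⁻¹' {c (u j)}) := by
      intro x hx
      by_cases hxu : x ≤ u
      · exact Or.inl hxu
      · right
        simp only [Pi.le_def, not_forall, not_le] at hxu
        obtain ⟨j, hj⟩ := hxu
        simp only [Set.mem_iUnion]
        exact ⟨j, Finset.mem_univ _, le_antisymm (hx j) (hmono hj.le)⟩
    refine (measureReal_mono hsub).trans ((measureReal_union_le _ _).trans ?_)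
    refine add_le_add le_rfl ((measureReal_biUnion_finset_le _ _).trans ?_)
    refine (Finset.sum_le_card_nsmul _ _ δ fun j _ => ?_).trans (by simp)
    have := hcδ (c (u j))
    rw [← D.isStochastic.map_eval j, Measure.map_apply (by fun_prop)
      (hc (measurableSet_singleton _))] at this
    exact ENNReal.toReal_le_of_le_ofReal hδ this
  refine Real.iSup_le (fun u => ?_) (by positivity)
  have h1 := key E u
  have h2 := key C u
  rw [hmap] at h1
  rw [abs_le]
  constructor <;> linarith [h1.1, h1.2, h2.1, h2.2]

end Copula

/-! ### Mixtures of measures on boxes and approximation of copulas -/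

/-- For every coordinate, a partition of the unit interval indexed by `ι`, such that the volume of
a part depends on its index only. -/
structure IntervalCoding (d : ℕ) (ι : Type*) [MeasurableSpace ι] where
  /-- The index of the part that contains a point. -/
  code : Fin d → unitInterval → ι
  /-- The volume of a part. -/
  weight : ι → ℝ≥0∞
  measurable_code : ∀ j, Measurable (code j)
  volume_code : ∀ j z, volume (code j ⁻¹' {z}) = weight z

namespace IntervalCoding

variable {d : ℕ} {ι : Type*} [MeasurableSpace ι]

/-- The parts with index `z`, replaced by the whole unit interval if they are negligible. -/
def part (K : IntervalCoding d ι) (z : ι) (j : Fin d) : Set unitInterval :=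
  open scoped Classical in if K.weight z = 0 then Set.univ else K.code j ⁻¹' {z}


instance (K : IntervalCoding d ι) (z : ι) (j : Fin d) :
    IsProbabilityMeasure ((volume : Measure unitInterval)[|K.part z j]) := by
  refine cond_isProbabilityMeasure ?_
  unfold part
  split_ifs with h
  · simp
  · rwa [K.volume_code]

/-- The uniform distribution on the product of the parts with index `z`. -/
def box (K : IntervalCoding d ι) (z : ι) : Measure (Fin d → unitInterval) :=
  Measure.pi fun j => (volume : Measure unitInterval)[|K.part z j]

instance (K : IntervalCoding d ι) (z : ι) : IsProbabilityMeasure (K.box z) := by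
  unfold box; infer_instance

theorem box_map_eval (K : IntervalCoding d ι) (z : ι) (j : Fin d) :
    (K.box z).map (fun x => x j) = volume[|K.part z j] :=
  (measurePreserving_eval (fun j => (volume : Measure unitInterval)[|K.part z j]) j).map_eq

theorem box_map_pair (K : IntervalCoding d ι) (z : ι) {i k : Fin d} (hik : i ≠ k) :
    (K.box z).map (fun x => (x i, x k))
      = ((volume : Measure unitInterval)[|K.part z i]).prod volume[|K.part z k] := by
  rw [← box_map_eval, ← box_map_eval]
  exact (indepFun_iff_map_prod_eq_prod_map_map (measurable_pi_apply i).aemeasurable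
    (measurable_pi_apply k).aemeasurable).1 (indepFun_pi_eval _ hik)

theorem part_eq (K : IntervalCoding d ι) {z : ι} (hz : K.weight z ≠ 0) (j : Fin d) :
    K.part z j = K.code j ⁻¹' {z} := if_neg hz

theorem exists_median (K : IntervalCoding d ι) (z : ι) (j : Fin d) :
    ∃ a, (volume : Measure unitInterval)[|K.part z j] (Set.Iic a) = 1 / 2 := by
  have : NullSingletonClass ((volume : Measure unitInterval)[|K.part z j]) :=
    ⟨fun x => cond_absolutelyContinuous (measure_singleton x)⟩
  exact exists_measure_Iic_eq _ (by simp)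

/-- The measures `M z` have the uniform distributions on the parts with index `z` as margins. -/
structure IsBoxFamily (K : IntervalCoding d ι) (M : ι → Measure (Fin d → unitInterval)) :
    Prop where
  isProbabilityMeasure : ∀ z, IsProbabilityMeasure (M z)
  map_eval : ∀ z, K.weight z ≠ 0 → ∀ j, (M z).map (fun x => x j) = volume[|K.code j ⁻¹' {z}]
  absolutelyContinuous : ∀ z, K.weight z ≠ 0 → M z ≪ volume

variable {K : IntervalCoding d ι} {M : ι → Measure (Fin d → unitInterval)}

theorem isBoxFamily_box (K : IntervalCoding d ι) : K.IsBoxFamily K.box :=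
  ⟨fun z => inferInstance, fun z hz j => by rw [box_map_eval, K.part_eq hz],
    fun z _ => pi_cond_absolutelyContinuous _⟩

variable [MeasurableSingletonClass ι]

theorem IsBoxFamily.ae_code (hM : K.IsBoxFamily M) {z : ι} (hz : K.weight z ≠ 0) (j : Fin d) :
    ∀ᵐ x ∂M z, K.code j (x j) = z := by
  have h : ∀ᵐ a ∂(M z).map (fun x => x j), K.code j a = z := by
    rw [hM.map_eval z hz j]
    exact ae_cond_mem (K.measurable_code j (measurableSet_singleton z))
  exact ae_of_ae_map (measurable_pi_apply j).aemeasurable h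

variable [Fintype ι]

theorem IsBoxFamily.map_eval_sum (hM : K.IsBoxFamily M) (j : Fin d) :
    (∑ z, K.weight z • M z).map (fun x => x j) = volume := by
  rw [← sum_meas_smul_cond_fiber (K.measurable_code j) volume]
  ext s hs
  rw [Measure.map_apply (by fun_prop) hs, Measure.finsetSum_apply, Measure.finsetSum_apply]
  refine Finset.sum_congr rfl fun z _ => ?_
  rw [K.volume_code, Measure.smul_apply, Measure.smul_apply]
  rcases eq_or_ne (K.weight z) 0 with h | h
  · simp [h]
  · rw [← hM.map_eval z h j, Measure.map_apply (by fun_prop) hs]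

theorem sum_weight (K : IntervalCoding d ι) (j : Fin d) : ∑ z, K.weight z = 1 := by
  simp_rw [← K.volume_code j]
  rw [sum_measure_preimage_singleton _ fun z _ => K.measurable_code j (measurableSet_singleton z)]
  simp

/-- The coordinate `j` witnesses `d > 0`: in dimension zero nothing forces the weights to sum to
one. -/
theorem IsBoxFamily.isStochastic (hM : K.IsBoxFamily M) (j : Fin d) :
    IsStochastic (∑ z, K.weight z • M z) := by
  refine ⟨⟨?_⟩, hM.map_eval_sum⟩
  have h := congrArg (fun μ : Measure unitInterval => μ Set.univ) (hM.map_eval_sum j)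
  simpa [Measure.map_apply (measurable_pi_apply j) MeasurableSet.univ] using h

/-- The copula that picks an index at random and then a point according to `M`. -/
@[simps] def mixture (hM : K.IsBoxFamily M) (j : Fin d) : Copula d :=
  ⟨∑ z, K.weight z • M z, hM.isStochastic j⟩

theorem mixture_hasContinuousCondCDFs (hM : K.IsBoxFamily M) (j : Fin d) :
    (mixture hM j).HasContinuousCondCDFs := by
  refine Copula.hasContinuousCondCDFs_of_absolutelyContinuous ?_
  intro s hs
  rw [mixture_measure, Measure.finsetSum_apply]
  refine Finset.sum_eq_zero fun z _ => ?_
  rcases eq_or_ne (K.weight z) 0 with h | h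
  · simp [h]
  · simp [hM.absolutelyContinuous z h hs]

/-- A single coordinate `l` of the conditioning set already reveals the index. -/
theorem condDistrib_mixture (hM : K.IsBoxFamily M) (j : Fin d) {L : Finset (Fin d)} {l : Fin d}
    (hl : l ∈ L) {S : Type*} [MeasurableSpace S] [StandardBorelSpace S] [Nonempty S]
    {Y : (Fin d → unitInterval) → S} (hY : Measurable Y)
    (hind : ∀ z, K.weight z ≠ 0 → IndepFun L.restrict Y (M z)) :
    ∀ᵐ t ∂(mixture hM j).marginal L, condDistrib Y L.restrict (mixture hM j).measure t
      = (M (K.code l (t ⟨l, hl⟩))).map Y := by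
  have := hM.isProbabilityMeasure
  have := (hM.isStochastic j).isProbabilityMeasure
  exact _root_.condDistrib_mixture (p := K.weight) (M := M) (X := L.restrict) (by fun_prop) hY hind
    (g := fun t => K.code l (t ⟨l, hl⟩)) ((K.measurable_code l).comp (measurable_pi_apply _))
    fun z hz => hM.ae_code hz l

end IntervalCoding

namespace Copula
variable {d : ℕ}

/-- The index is a grid cell, and the code of a point in coordinate `j` has as `j`-th entry the grid
interval of that point. Hence `M z` lives on the cell `z`, and every mixture has the grid masses of
`C` whatever the dependence within the boxes. The bound on the weights later guarantees more than
one box. -/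
theorem exists_intervalCoding (C : Copula d) {δ : ℝ} (hδ : 0 < δ) :
    ∃ (m : ℕ) (K : IntervalCoding d (Fin d → Fin m)),
      (∀ z, 0 < d → K.weight z ≤ ENNReal.ofReal δ) ∧
      ∀ (M : _) (hM : K.IsBoxFamily M) (j : Fin d),
        dist (IntervalCoding.mixture hM j) C ≤ d * δ := by
  classical
  obtain ⟨m, c, hc, hmono, hcδ⟩ := exists_grid hδ
  have hg : Measurable fun (x : Fin d → unitInterval) j => c (x j) := by fun_prop
  set p : (Fin d → Fin m) → ℝ≥0∞ := fun z => C.measure ((fun x j => c (x j)) ⁻¹' {z}) with hp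
  -- The masses of the cells in the slab `z j = a` add up to the length of interval `a`, as
  -- coordinate `j` is uniform under `C`.
  have hex : ∀ (j : Fin d) (a : Fin m), ∃ f : unitInterval → Fin d → Fin m, Measurable f ∧
      (∀ x, f x j = a) ∧ ∀ z : Fin d → Fin m, z j = a →
        volume.restrict (c ⁻¹' {a}) (f ⁻¹' {z}) = p z := by
    intro j a
    have hsum : ∑ z with z j = a, p z
        = (volume : Measure unitInterval).restrict (c ⁻¹' {a}) Set.univ := by
      rw [hp, sum_measure_preimage_singleton _ fun z _ => hg (measurableSet_singleton z),
        Measure.restrict_apply_univ, ← C.isStochastic.map_eval j,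
        Measure.map_apply (by fun_prop) (hc (measurableSet_singleton a))]
      congr 1
      ext x
      simp
    obtain ⟨f, h1, h2, h3⟩ := exists_measurable_coding ({z | z j = a} : Finset (Fin d → Fin m))
      ⟨fun _ => a, by simp⟩ p _ hsum
    exact ⟨f, h1, fun x => by simpa using h2 x, fun z hz => h3 z (by simpa using hz)⟩
  choose f hf hfa hfp using hex
  have hcode : ∀ j x, f j (c x) x j = c x := fun j x => hfa j (c x) x
  let K : IntervalCoding d (Fin d → Fin m) :=
    { code := fun j x => f j (c x) x
      weight := p
      measurable_code := fun j => (measurable_from_prod_countable_right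
        (f := fun q : Fin m × unitInterval => f j q.1 q.2) fun a => hf j a).comp
        (hc.prodMk measurable_id)
      volume_code := fun j z => by
        rw [← hfp j (z j) z rfl, Measure.restrict_apply (hf j _ (measurableSet_singleton z))]
        congr 1
        ext x
        simp only [Set.mem_preimage, Set.mem_singleton_iff, Set.mem_inter_iff]
        constructor
        · intro h
          have : c x = z j := by rw [← hcode j x, h]
          exact ⟨this ▸ h, this⟩
        · rintro ⟨h1, h2⟩
          rw [h2, h1] }
  refine ⟨m, K, fun z hd => ?_, fun M hM j => dist_le_of_grid hc hmono hδ.le hcδ fun z => ?_⟩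
  · rw [← K.volume_code ⟨0, hd⟩]
    refine (measure_mono fun x hx => ?_).trans (hcδ (z ⟨0, hd⟩))
    have hx' : f ⟨0, hd⟩ (c x) x = z := hx
    simp only [Set.mem_preimage, Set.mem_singleton_iff]
    rw [← hcode ⟨0, hd⟩ x, hx']
  · have := hM.isProbabilityMeasure
    rw [IntervalCoding.mixture_measure, Measure.finsetSum_apply, Finset.sum_eq_single z]
    · rcases eq_or_ne (K.weight z) 0 with h | h
      · rw [h, zero_smul]; exact h.symm
      have h1 : M z ((fun x j => c (x j)) ⁻¹' {z}) = 1 := by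
        rw [← measure_univ (μ := M z)]
        refine measure_congr (Filter.eventuallyEq_univ.2 ?_)
        filter_upwards [ae_all_iff.2 (hM.ae_code h)] with x hx
        funext j
        have h2 : f j (c (x j)) (x j) = z := hx j
        rw [← h2, hcode]
      rw [Measure.smul_apply, h1, smul_eq_mul, mul_one]
    · intro w _ hw
      rcases eq_or_ne (K.weight w) 0 with h | h
      · simp [h]
      have h1 : M w ((fun x j => c (x j)) ⁻¹' {z}) = 0 := by
        rw [measure_eq_zero_iff_ae_notMem]
        filter_upwards [ae_all_iff.2 (hM.ae_code h)] with x hx hxz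
        refine hw (funext fun j => ?_)
        have h2 : f j (c (x j)) (x j) = w := hx j
        rw [← h2, hcode, ← hxz]
      rw [Measure.smul_apply, h1, smul_zero]
    · simp

theorem marginal_Icc_real_eq_integral (C : Copula d) {i k : Fin d} (hik : i ≤ k)
    (u : Fin d → unitInterval) :
    (C.marginal (Finset.Icc i k)).real (Set.Iic ((Finset.Icc i k).restrict u))
      = ∫ t in Set.Iic ((Finset.Ioo i k).restrict u),
        (C.condPair i k (Finset.Ioo i k) t).real (Set.Iic ![u i, u k])
          ∂C.marginal (Finset.Ioo i k) := by
  have hm : Measurable fun x : Fin d → unitInterval => ![x i, x k] :=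
    measurable_vec₂ (measurable_pi_apply i) (measurable_pi_apply k)
  have : IsMarkovKernel (C.condPair i k (Finset.Ioo i k)) := by unfold condPair; infer_instance
  have h : C.measure.map (fun x => ((Finset.Ioo i k).restrict x, x i, x k))
        (Set.Iic ((Finset.Ioo i k).restrict u) ×ˢ (Set.Iic (u i) ×ˢ Set.Iic (u k)))
      = C.measure.map (fun x => ((Finset.Ioo i k).restrict x, ![x i, x k]))
        (Set.Iic ((Finset.Ioo i k).restrict u) ×ˢ Set.Iic ![u i, u k]) := by
    rw [Measure.map_apply (by fun_prop) (measurableSet_Iic.prod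
      (measurableSet_Iic.prod measurableSet_Iic)), Measure.map_apply
      ((by fun_prop : Measurable (Finset.Ioo i k).restrict).prodMk hm)
      (measurableSet_Iic.prod measurableSet_Iic)]
    congr 1
    ext x
    have h2 : ![x i, x k] ≤ ![u i, u k] ↔ x i ≤ u i ∧ x k ≤ u k := by
      simp [Pi.le_def, Fin.forall_fin_two]
    simp [h2]
  rw [Measure.real, marginal_Icc_Iic _ hik, h, ← compProd_map_condDistrib hm.aemeasurable,
    Measure.compProd_apply_prod measurableSet_Iic measurableSet_Iic]
  exact (integral_toReal (Kernel.measurable_coe _ measurableSet_Iic).aemeasurable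
    (.of_forall fun w => measure_lt_top _ _)).symm

/-! ### Conditional independence, fixed points and discontinuity -/

/-- All pairs of coordinates are conditionally independent given the coordinates between them. -/
def IsCondIndep (C : Copula d) : Prop :=
  ∀ i k : Fin d, (i : ℕ) + 2 ≤ k → ∀ᵐ t ∂C.marginal (Finset.Ioo i k), ∀ a b : unitInterval,
    (C.condPair i k (Finset.Ioo i k) t).real (Set.Iic ![a, b])
      = C.condCDF i (Finset.Ioo i k) a t * C.condCDF k (Finset.Ioo i k) b t

/-- Sklar's identity determines the conditional copula only on the ranges of the conditional
distribution functions; surjectivity makes this the whole square. -/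
theorem ae_condCDF_surjective {C : Copula d} (hC : C.HasContinuousCondCDFs) {j : Fin d}
    {L : Finset (Fin d)} (hL : L.Nonempty) (hLd : L.card + 2 ≤ d) (hj : j ∉ L) :
    ∀ᵐ t ∂C.marginal L, Function.Surjective fun a => C.condCDF j L a t := by
  filter_upwards [hC L j hL hLd hj, C.ae_condCDF_zero j L] with t h1 h2
  exact distFun_surjective h1 h2

/-- Induction on block length. By induction `D_L = C_L`, so the almost sure identity `A w =
independence` also holds for the measure used in the average. The partial copula is then the product
and the block equation is the disintegration of `C`. -/
theorem IsCondIndep.eq_of_isPartialDVine {C D : Copula d} (hC : C.HasContinuousCondCDFs)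
    (hind : C.IsCondIndep) (hD : C.IsPartialDVine D) (hd : 2 ≤ d) : D = C := by
  have key : ∀ (n : ℕ) (i k : Fin d), (k : ℕ) = i + n + 1 →
      D.marginal (Finset.Icc i k) = C.marginal (Finset.Icc i k) := by
    intro n
    induction n with
    | zero =>
      intro i k hk
      refine marginal_mono (K := {i, k}) (fun j hj => ?_) (hD.pairs i k hk.symm)
      rw [Finset.mem_Icc, Fin.le_def, Fin.le_def] at hj
      simp only [Finset.mem_insert, Finset.mem_singleton, Fin.ext_iff]
      omega
    | succ n ih =>
      intro i k hk
      have hik : (i : ℕ) + 2 ≤ k := by omega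
      have hlt : i < k := Fin.lt_def.2 (by omega)
      have hIco : D.marginal (Finset.Ico i k) = C.marginal (Finset.Ico i k) := by
        refine marginal_mono (fun j hj => ?_) (ih i ⟨i + n + 1, by have := k.2; omega⟩ rfl)
        rw [Finset.mem_Ico, Fin.le_def, Fin.lt_def] at hj
        rw [Finset.mem_Icc, Fin.le_def, Fin.le_def]
        exact ⟨hj.1, by simp; omega⟩
      have hIoc : D.marginal (Finset.Ioc i k) = C.marginal (Finset.Ioc i k) := by
        refine marginal_mono (fun j hj => ?_) (ih ⟨i + 1, by have := k.2; omega⟩ k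
          (by simp; omega))
        rw [Finset.mem_Ioc, Fin.le_def, Fin.lt_def] at hj
        rw [Finset.mem_Icc, Fin.le_def, Fin.le_def]
        exact ⟨by simp; omega, hj.2⟩
      have hL := marginal_mono Finset.Ioo_subset_Ico_self hIco
      obtain ⟨A, hA, hblock⟩ := hD.blocks i k hik
      have hAprod : ∀ᵐ w ∂C.marginal (Finset.Ioo i k), ∀ a b : unitInterval,
          (A w).real (Set.Iic ![a, b]) = a * b := by
        filter_upwards [hA.sklar, hind i k hik, ae_condCDF_surjective hC (nonempty_Ioo hik)
          (card_Ioo_add_two_le hik) (by simp : i ∉ Finset.Ioo i k),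
          ae_condCDF_surjective hC (nonempty_Ioo hik) (card_Ioo_add_two_le hik)
          (by simp : k ∉ Finset.Ioo i k)] with w h1 h2 h3 h4 a b
        obtain ⟨a', rfl⟩ := h3 a
        obtain ⟨b', rfl⟩ := h4 b
        exact (h1 a' b').symm.trans (h2 a' b')
      refine ext_of_pi_Iic fun v => ?_
      obtain ⟨u, rfl⟩ : ∃ u : Fin d → unitInterval, (Finset.Icc i k).restrict u = v := by
        classical
        exact ⟨fun j => if hj : j ∈ Finset.Icc i k then v ⟨j, hj⟩ else 0,
          funext fun j => dif_pos j.2⟩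
      rw [← measureReal_eq_measureReal_iff, hblock u, marginal_Icc_real_eq_integral _ hlt.le, hL,
        condCDF_congr Finset.Ioo_subset_Ico_self (by simpa using hlt) hIco,
        condCDF_congr Finset.Ioo_subset_Ioc_self (by simpa using hlt) hIoc]
      refine integral_congr_ae (ae_restrict_of_ae ?_)
      filter_upwards [hind i k hik] with t ht
      rw [ht, integral_congr_ae (hAprod.mono fun w hw => hw _ _)]
      simp
  -- `n` counts the coordinates strictly between the ends, so `d - 2` gives the block of all
  -- coordinates.
  have huniv := key (d - 2) ⟨0, by omega⟩ ⟨d - 1, by omega⟩ (by simp; omega)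
  refine ext_of_apply fun u => ?_
  have hmar : ∀ E : Copula d, E u = (E.marginal (Finset.Icc ⟨0, by omega⟩ ⟨d - 1, by omega⟩)).real
      (Set.Iic (Finset.restrict _ u)) := fun E => by
    rw [marginal, map_measureReal_apply (by fun_prop) measurableSet_Iic]
    refine congrArg E.measure.real (Set.ext fun x => ?_)
    simp only [Set.mem_preimage, Set.mem_Iic, Pi.le_def, Finset.restrict, Subtype.forall]
    refine ⟨fun h j _ => h j, fun h j => h j ?_⟩
    rw [Finset.mem_Icc, Fin.le_def, Fin.le_def]
    have := j.2
    simp; omega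
  rw [hmar, hmar, huniv]

end Copula

theorem IntervalCoding.isCondIndep_mixture_box {d : ℕ} {ι : Type*} [MeasurableSpace ι] [Fintype ι]
    [MeasurableSingletonClass ι] (K : IntervalCoding d ι) (j : Fin d) :
    (mixture K.isBoxFamily_box j).IsCondIndep := by
  intro i k hik
  have hm : Measurable fun x : Fin d → unitInterval => ![x i, x k] :=
    measurable_vec₂ (measurable_pi_apply i) (measurable_pi_apply k)
  have hne : i ≠ k := by rintro rfl; omega
  obtain ⟨l, hl⟩ := Copula.nonempty_Ioo hik
  have h0 := condDistrib_mixture K.isBoxFamily_box j hl hm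
    fun z _ => indepFun_restrict_pi_pair _ (by simp) (by simp)
  have h1 := condDistrib_mixture K.isBoxFamily_box j hl (measurable_pi_apply i)
    fun z _ => indepFun_restrict_pi_eval _ (by simp)
  have h2 := condDistrib_mixture K.isBoxFamily_box j hl (measurable_pi_apply k)
    fun z _ => indepFun_restrict_pi_eval _ (by simp)
  filter_upwards [h0, h1, h2] with t h0 h1 h2 a b
  simp only [Copula.condPair, Copula.condCDF]
  rw [h0, h1, h2, map_measureReal_apply hm measurableSet_Iic,
    map_measureReal_apply (measurable_pi_apply i) measurableSet_Iic,
    map_measureReal_apply (measurable_pi_apply k) measurableSet_Iic]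
  have h := (indepFun_pi_eval (fun j => (volume : Measure unitInterval)[|K.part
    (K.code l (t ⟨l, hl⟩)) j]) hne).measure_inter_preimage_eq_mul (Set.Iic a) (Set.Iic b)
    measurableSet_Iic measurableSet_Iic
  have h' := congrArg ENNReal.toReal h
  rw [ENNReal.toReal_mul] at h'
  refine Eq.trans ?_ h'
  rw [Measure.real]
  congr 2
  ext x
  simp [Pi.le_def, Fin.forall_fin_two]

/-- The approximating mixture of product measures is its own only partial D-vine copula, hence fixed
by any `ψ`. -/
theorem exists_fixed_near {d : ℕ} (hd : 2 ≤ d) {ψ : ContCopula d → Copula d}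
    (hψ : IsPartialDVineMap ψ) (C : Copula d) {ε : ℝ} (hε : 0 < ε) :
    ∃ E : ContCopula d, dist E.1 C < ε ∧ ψ E = E.1 := by
  have hd0 : (0 : ℝ) < d := by positivity
  obtain ⟨m, K, -, hK⟩ := C.exists_intervalCoding (δ := ε / (2 * d)) (by positivity)
  let j : Fin d := ⟨0, by omega⟩
  have hc := IntervalCoding.mixture_hasContinuousCondCDFs K.isBoxFamily_box j
  refine ⟨⟨IntervalCoding.mixture K.isBoxFamily_box j, hc⟩,
    (hK _ K.isBoxFamily_box j).trans_lt ?_, ?_⟩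
  · rw [show (d : ℝ) * (ε / (2 * d)) = ε / 2 by field_simp]; linarith
  · exact (K.isCondIndep_mixture_box j).eq_of_isPartialDVine hc (hψ _) hd

/-- By continuity, a fixed point near `C` would be within half of `dist C (ψ C)` of both `C` and `ψ
C`. -/
theorem not_continuousAt_of_dist_ne_zero {d : ℕ} (hd : 2 ≤ d) {ψ : ContCopula d → Copula d}
    (hψ : IsPartialDVineMap ψ) (C : ContCopula d) (hC : dist C.1 (ψ C) ≠ 0) :
    ¬ ContinuousAt ψ C := by
  intro hcont
  have hpos : 0 < dist C.1 (ψ C) := lt_of_le_of_ne dist_nonneg hC.symm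
  obtain ⟨δ, hδ, h⟩ := Metric.continuousAt_iff.1 hcont (dist C.1 (ψ C) / 2) (by positivity)
  obtain ⟨E, hE, hfix⟩ := exists_fixed_near hd hψ C.1 (lt_min hδ (half_pos hpos))
  have h1 := h (show dist E C < δ from hE.trans_le (min_le_left _ _))
  rw [hfix] at h1
  have h2 := hE.trans_le (min_le_right _ _)
  have h3 := dist_triangle_left C.1 (ψ C) E.1
  linarith

/-! ### Conditioning on events and on a median diagonal -/

/-- The measures with densities `f` and `g` agree on lower orthants, hence coincide. -/
theorem ae_eq_of_setIntegral_Iic {J : Type*} [Fintype J] {μ : Measure (J → unitInterval)}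
    [IsFiniteMeasure μ] {f g : (J → unitInterval) → ℝ} (hf : Measurable f) (hg : Measurable g)
    (hf0 : ∀ t, 0 ≤ f t) (hg0 : ∀ t, 0 ≤ g t) (hfi : Integrable f μ) (hgi : Integrable g μ)
    (h : ∀ u, ∫ t in Set.Iic u, f t ∂μ = ∫ t in Set.Iic u, g t ∂μ) : f =ᵐ[μ] g := by
  have hfin := isFiniteMeasure_withDensity_ofReal hfi.2
  have key : μ.withDensity (fun t => ENNReal.ofReal (f t))
      = μ.withDensity (fun t => ENNReal.ofReal (g t)) := by
    refine ext_of_pi_Iic fun u => ?_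
    rw [withDensity_apply _ measurableSet_Iic, withDensity_apply _ measurableSet_Iic,
      ← ofReal_integral_eq_lintegral_ofReal hfi.integrableOn (.of_forall hf0),
      ← ofReal_integral_eq_lintegral_ofReal hgi.integrableOn (.of_forall hg0), h]
  have h' := (withDensity_eq_iff_of_sigmaFinite hf.ennreal_ofReal.aemeasurable
    hg.ennreal_ofReal.aemeasurable).1 key
  filter_upwards [h'] with t ht
  exact (ENNReal.ofReal_eq_ofReal_iff (hf0 t) (hg0 t)).1 ht

section conditioning

variable {Ω S T : Type*} [MeasurableSpace Ω] [MeasurableSpace S] [MeasurableSpace T]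
  {μ : Measure Ω} {X : Ω → S} {Y : Ω → T}

theorem map_cond_preimage (hY : Measurable Y) {W : Set T} (hW : MeasurableSet W) :
    (μ[|Y ⁻¹' W]).map Y = (μ.map Y)[|W] := by
  ext s hs
  rw [Measure.map_apply hY hs, cond_apply (hY hW), cond_apply hW, Measure.map_apply hY hW,
    Measure.map_apply hY (hW.inter hs)]
  rfl

theorem ProbabilityTheory.IndepFun.cond_preimage_inter (hind : IndepFun X Y μ) (hY : Measurable Y)
    {W : Set T} (hW : MeasurableSet W) {s : Set S} (hs : MeasurableSet s) {t : Set T}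
    (ht : MeasurableSet t) :
    μ[|Y ⁻¹' W] (X ⁻¹' s ∩ Y ⁻¹' t) = μ (X ⁻¹' s) * μ[|Y ⁻¹' W] (Y ⁻¹' t) := by
  rw [cond_apply (hY hW), cond_apply (hY hW), Set.inter_left_comm, ← Set.preimage_inter,
    hind.measure_inter_preimage_eq_mul _ _ hs (hW.inter ht)]
  ring

theorem ProbabilityTheory.IndepFun.map_cond_preimage_left [IsFiniteMeasure μ]
    (hind : IndepFun X Y μ)
    (hX : Measurable X) (hY : Measurable Y) {W : Set T} (hW : MeasurableSet W)
    (h0 : μ (Y ⁻¹' W) ≠ 0) : (μ[|Y ⁻¹' W]).map X = μ.map X := by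
  have := cond_isProbabilityMeasure h0
  ext s hs
  have h := hind.cond_preimage_inter hY hW hs MeasurableSet.univ
  rw [Measure.map_apply hX hs, Measure.map_apply hX hs]
  simpa using h

theorem ProbabilityTheory.IndepFun.cond_preimage [IsFiniteMeasure μ] (hind : IndepFun X Y μ)
    (hX : Measurable X) (hY : Measurable Y) {W : Set T} (hW : MeasurableSet W)
    (h0 : μ (Y ⁻¹' W) ≠ 0) : IndepFun X Y (μ[|Y ⁻¹' W]) := by
  refine indepFun_iff_measure_inter_preimage_eq_mul.2 fun s t hs ht => ?_
  rw [hind.cond_preimage_inter hY hW hs ht, ← Measure.map_apply hX hs,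
    ← hind.map_cond_preimage_left hX hY hW h0, Measure.map_apply hX hs]

end conditioning

section diagonal

variable {S T : Type*} [MeasurableSpace S] [MeasurableSpace T] {μ : Measure S} {ν : Measure T}
  [IsProbabilityMeasure ν] {A : Set S} {B : Set T}

/-- Every section of the diagonal set over a point of `S` is `B` or its complement, of mass 1/2
either way. Conditioning on the set therefore preserves the first marginal. -/
theorem prod_diagonal_inter (hA : MeasurableSet A) (hB : MeasurableSet B) (hνB : ν B = 1 / 2)
    {s : Set S} (hs : MeasurableSet s) :
    μ.prod ν ((A ×ˢ B ∪ Aᶜ ×ˢ Bᶜ) ∩ Prod.fst ⁻¹' s) = 1 / 2 * μ s := by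
  have hνB' : ν Bᶜ = 1 / 2 := by
    rw [prob_compl_eq_one_sub hB, hνB]; simp
  have h1 : (A ×ˢ B ∪ Aᶜ ×ˢ Bᶜ) ∩ Prod.fst ⁻¹' s = (s ∩ A) ×ˢ B ∪ (s \ A) ×ˢ Bᶜ := by
    ext q; simp; tauto
  rw [h1, measure_union ?_ ((hs.diff hA).prod hB.compl), Measure.prod_prod, Measure.prod_prod, hνB,
    hνB', ← add_mul, measure_inter_add_sdiff s hA, mul_comm]
  rw [Set.disjoint_left]
  rintro q ⟨h1, -⟩ ⟨h2, -⟩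
  exact h2.2 h1.2

variable [IsProbabilityMeasure μ]

theorem prod_diagonal (hA : MeasurableSet A) (hB : MeasurableSet B) (hνB : ν B = 1 / 2) :
    μ.prod ν (A ×ˢ B ∪ Aᶜ ×ˢ Bᶜ) = 1 / 2 := by
  simpa using prod_diagonal_inter (μ := μ) hA hB hνB MeasurableSet.univ

theorem measurableSet_diagonal (hA : MeasurableSet A) (hB : MeasurableSet B) :
    MeasurableSet (A ×ˢ B ∪ Aᶜ ×ˢ Bᶜ) := (hA.prod hB).union (hA.compl.prod hB.compl)

theorem map_fst_cond_diagonal (hA : MeasurableSet A) (hB : MeasurableSet B) (hνB : ν B = 1 / 2) :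
    ((μ.prod ν)[|A ×ˢ B ∪ Aᶜ ×ˢ Bᶜ]).map Prod.fst = μ := by
  ext s hs
  rw [Measure.map_apply measurable_fst hs, cond_apply (measurableSet_diagonal hA hB),
    prod_diagonal hA hB hνB, prod_diagonal_inter hA hB hνB hs, ← mul_assoc,
    ENNReal.inv_mul_cancel (by simp) (by simp), one_mul]

theorem map_snd_cond_diagonal (hA : MeasurableSet A) (hB : MeasurableSet B) (hμA : μ A = 1 / 2) :
    ((μ.prod ν)[|A ×ˢ B ∪ Aᶜ ×ˢ Bᶜ]).map Prod.snd = ν := by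
  have hsw : (μ.prod ν)[|A ×ˢ B ∪ Aᶜ ×ˢ Bᶜ]
      = ((ν.prod μ)[|B ×ˢ A ∪ Bᶜ ×ˢ Aᶜ]).map Prod.swap := by
    have h : A ×ˢ B ∪ Aᶜ ×ˢ Bᶜ = Prod.swap ⁻¹' (B ×ˢ A ∪ Bᶜ ×ˢ Aᶜ) := by
      ext q; simp
    have h' : (ν.prod μ)[|B ×ˢ A ∪ Bᶜ ×ˢ Aᶜ]
        = ((μ.prod ν)[|A ×ˢ B ∪ Aᶜ ×ˢ Bᶜ]).map Prod.swap := by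
      rw [h, map_cond_preimage measurable_swap (measurableSet_diagonal hB hA), Measure.prod_swap]
    rw [h', Measure.map_map measurable_swap measurable_swap, Prod.swap_swap_eq, Measure.map_id]
  rw [hsw, Measure.map_map measurable_snd measurable_swap]
  exact map_fst_cond_diagonal hB hA hμA

theorem cond_diagonal_prod (hA : MeasurableSet A) (hB : MeasurableSet B) (hμA : μ A = 1 / 2)
    (hνB : ν B = 1 / 2) : (μ.prod ν)[|A ×ˢ B ∪ Aᶜ ×ˢ Bᶜ] (A ×ˢ B) = 1 / 2 := by
  rw [cond_apply (measurableSet_diagonal hA hB), prod_diagonal hA hB hνB,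
    Set.inter_eq_self_of_subset_right Set.subset_union_left, Measure.prod_prod, hμA, hνB,
    ← mul_assoc, ENNReal.inv_mul_cancel (by simp) (by simp), one_mul]

end diagonal

/-! ### Mixtures that are not their own partial D-vine copula -/

namespace IntervalCoding

variable {d : ℕ} {ι : Type*} [MeasurableSpace ι]
  {K : IntervalCoding d ι} {M : ι → Measure (Fin d → unitInterval)}

/-- The uniform distribution on the product of the parts with index `z`, conditioned on the
coordinates `i` and `k` being on the same side of `a` and `b`, respectively. -/
def diagonalBox (K : IntervalCoding d ι) (z : ι) (i k : Fin d) (a b : unitInterval) :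
    Measure (Fin d → unitInterval) :=
  (K.box z)[|(fun x => (x i, x k)) ⁻¹'
    (Set.Iic a ×ˢ Set.Iic b ∪ (Set.Iic a)ᶜ ×ˢ (Set.Iic b)ᶜ)]

section diagonalBox

variable {z : ι} {i k : Fin d} {a b : unitInterval}

theorem box_diagonal_ne_zero (hik : i ≠ k)
    (hb : (volume : Measure unitInterval)[|K.part z k] (Set.Iic b) = 1 / 2) :
    K.box z ((fun x => (x i, x k)) ⁻¹'
      (Set.Iic a ×ˢ Set.Iic b ∪ (Set.Iic a)ᶜ ×ˢ (Set.Iic b)ᶜ)) ≠ 0 := by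
  rw [← Measure.map_apply (by fun_prop) (measurableSet_diagonal measurableSet_Iic
    measurableSet_Iic), box_map_pair K z hik, prod_diagonal measurableSet_Iic measurableSet_Iic hb]
  simp

theorem diagonalBox_map_pair (hik : i ≠ k) : (K.diagonalBox z i k a b).map (fun x => (x i, x k))
    = (((volume : Measure unitInterval)[|K.part z i]).prod volume[|K.part z k])[|
      Set.Iic a ×ˢ Set.Iic b ∪ (Set.Iic a)ᶜ ×ˢ (Set.Iic b)ᶜ] := by
  rw [diagonalBox, map_cond_preimage (by fun_prop) (measurableSet_diagonal measurableSet_Iic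
    measurableSet_Iic), box_map_pair K z hik]

/-- For `i` and `k` the medians balance the two halves; the other coordinates are independent of the
conditioning event. -/
theorem diagonalBox_map_eval (hik : i ≠ k)
    (ha : (volume : Measure unitInterval)[|K.part z i] (Set.Iic a) = 1 / 2)
    (hb : (volume : Measure unitInterval)[|K.part z k] (Set.Iic b) = 1 / 2) (j : Fin d) :
    (K.diagonalBox z i k a b).map (fun x => x j) = volume[|K.part z j] := by
  rcases eq_or_ne j i with rfl | hji
  · rw [← map_fst_cond_diagonal (μ := (volume : Measure unitInterval)[|K.part z j])
      measurableSet_Iic measurableSet_Iic hb (A := Set.Iic a), ← diagonalBox_map_pair hik,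
      Measure.map_map measurable_fst (by fun_prop)]
    rfl
  rcases eq_or_ne j k with rfl | hjk
  · rw [← map_snd_cond_diagonal (ν := (volume : Measure unitInterval)[|K.part z j])
      measurableSet_Iic measurableSet_Iic ha (B := Set.Iic b), ← diagonalBox_map_pair hik,
      Measure.map_map measurable_snd (by fun_prop)]
    rfl
  have hind : IndepFun (fun x : Fin d → unitInterval => x j) (fun x => (x i, x k)) (K.box z) :=
    ((indepFun_restrict_pi_pair (L := {j}) _ (by simpa using hji.symm)
      (by simpa using hjk.symm)).comp
      (measurable_pi_apply (⟨j, Finset.mem_singleton_self j⟩ : ({j} : Finset (Fin d))))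
      ((measurable_pi_apply 0).prodMk (measurable_pi_apply 1)))
  rw [diagonalBox, hind.map_cond_preimage_left (measurable_pi_apply j) (by fun_prop)
    (measurableSet_diagonal measurableSet_Iic measurableSet_Iic) (box_diagonal_ne_zero hik hb),
    box_map_eval]

theorem isBoxFamily_update [DecidableEq ι] (hik : i ≠ k)
    (ha : (volume : Measure unitInterval)[|K.part z i] (Set.Iic a) = 1 / 2)
    (hb : (volume : Measure unitInterval)[|K.part z k] (Set.Iic b) = 1 / 2) :
    K.IsBoxFamily (Function.update K.box z (K.diagonalBox z i k a b)) := by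
  refine ⟨fun w => ?_, fun w hw j => ?_, fun w hw => ?_⟩
  · rcases eq_or_ne w z with rfl | h
    · rw [Function.update_self]
      exact cond_isProbabilityMeasure (box_diagonal_ne_zero hik hb)
    · rw [Function.update_of_ne h]; infer_instance
  · rcases eq_or_ne w z with rfl | h
    · rw [Function.update_self, diagonalBox_map_eval hik ha hb, K.part_eq hw]
    · rw [Function.update_of_ne h]; exact K.isBoxFamily_box.map_eval w hw j
  · rcases eq_or_ne w z with rfl | h
    · rw [Function.update_self]
      exact cond_absolutelyContinuous.trans (K.isBoxFamily_box.absolutelyContinuous w hw)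
    · rw [Function.update_of_ne h]; exact K.isBoxFamily_box.absolutelyContinuous w hw

end diagonalBox

variable [Fintype ι] [MeasurableSingletonClass ι]

/-- The block equation says that, for almost every `t`, the conditional pair law is the partial
copula `m` composed with the conditional distribution functions, and `m` does not depend on `t`. At
the medians of any box this gives the one number `m(1/2, 1/2)`. -/
theorem exists_const_of_isPartialDVine_self (hM : K.IsBoxFamily M) {i k : Fin d}
    (hik : (i : ℕ) + 2 ≤ k)
    (hind : ∀ z, K.weight z ≠ 0 →
      IndepFun (Finset.Ioo i k).restrict (fun x : Fin d → unitInterval => (x i, x k)) (M z))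
    (hself : (mixture hM i).IsPartialDVine (mixture hM i)) :
    ∃ c : ℝ, ∀ z, K.weight z ≠ 0 → ∀ a b,
      (M z).map (fun x => x i) (Set.Iic a) = 1 / 2 → (M z).map (fun x => x k) (Set.Iic b) = 1 / 2 →
      ((M z).map fun x => (x i, x k)).real (Set.Iic a ×ˢ Set.Iic b) = c := by
  classical
  set E := mixture hM i with hE
  have hlt : i < k := Fin.lt_def.2 (by omega)
  obtain ⟨l, hl⟩ := Copula.nonempty_Ioo hik
  obtain ⟨A, hA, hblock⟩ := hself.blocks i k hik
  have : IsMarkovKernel A := ⟨fun w => (hA.isStochastic w).isProbabilityMeasure⟩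
  have hm := IsStochastic.bind (μ := E.marginal (Finset.Ioo i k)) hA.isStochastic
  have := hm.isProbabilityMeasure
  simp_rw [← bind_real_apply A measurableSet_Iic] at hblock
  generalize A ∘ₘ E.marginal (Finset.Ioo i k) = m at hm hblock this
  let half : unitInterval := ⟨1 / 2, by norm_num, by norm_num⟩
  refine ⟨m.real (Set.Iic ![half, half]), fun z hz a b ha hb => ?_⟩
  have : IsMarkovKernel (E.condPair i k (Finset.Ioo i k)) := by
    unfold Copula.condPair; infer_instance
  have hae : (fun t => (E.condPair i k (Finset.Ioo i k) t).real (Set.Iic ![a, b]))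
      =ᵐ[E.marginal (Finset.Ioo i k)] fun t => m.real (Set.Iic
        ![E.condCDF i (Finset.Ioo i k) a t, E.condCDF k (Finset.Ioo i k) b t]) := by
    have hg : Measurable fun t => m.real (Set.Iic
        ![E.condCDF i (Finset.Ioo i k) a t, E.condCDF k (Finset.Ioo i k) b t]) := by
      have h := (glueKernel (condDistrib (fun x => x i) (Finset.Ioo i k).restrict E.measure)
        (condDistrib (fun x => x k) (Finset.Ioo i k).restrict E.measure) m).measurable_coe
        (measurableSet_Iic (a := a) |>.prod (measurableSet_Iic (a := b)))
      simp only [glueKernel_Iic] at h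
      exact h.ennreal_toReal
    have hf : Measurable fun t =>
        (E.condPair i k (Finset.Ioo i k) t).real (Set.Iic ![a, b]) :=
      (Kernel.measurable_coe _ measurableSet_Iic).ennreal_toReal
    refine ae_eq_of_setIntegral_Iic hf hg (fun _ => measureReal_nonneg)
      (fun _ => measureReal_nonneg)
      (Integrable.of_bound hf.aestronglyMeasurable 1 (.of_forall fun t => ?_))
      (Integrable.of_bound hg.aestronglyMeasurable 1 (.of_forall fun t => ?_)) fun v => ?_
    · rw [Real.norm_of_nonneg measureReal_nonneg]; exact measureReal_le_one
    · rw [Real.norm_of_nonneg measureReal_nonneg]; exact measureReal_le_one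
    let u : Fin d → unitInterval := fun j =>
      if hj : j ∈ Finset.Ioo i k then v ⟨j, hj⟩ else if j = i then a else b
    have hu : (Finset.Ioo i k).restrict u = v := funext fun j => dif_pos j.2
    have hui : u i = a := by simp [u]
    have huk : u k = b := by simp [u, hlt.ne']
    have h := hblock u
    rwa [Copula.marginal_Icc_real_eq_integral _ hlt.le, hu, hui, huk] at h
  have hm2 : Measurable fun x : Fin d → unitInterval => ![x i, x k] :=
    measurable_vec₂ (measurable_pi_apply i) (measurable_pi_apply k)
  have h0 := condDistrib_mixture hM i hl hm2 fun z hz =>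
    (hind z hz).comp measurable_id (measurable_vec₂ measurable_fst measurable_snd)
  have h1 := condDistrib_mixture hM i hl (measurable_pi_apply i) fun z hz =>
    (hind z hz).comp measurable_id measurable_fst
  have h2 := condDistrib_mixture hM i hl (measurable_pi_apply k) fun z hz =>
    (hind z hz).comp measurable_id measurable_snd
  -- Conditioning values with index `z` are not negligible, so one of them lies outside all the
  -- exceptional null sets.
  have hex : ∃ᶠ t in ae (E.marginal (Finset.Ioo i k)), K.code l (t ⟨l, hl⟩) = z := by
    intro hcon
    have h3 : ∀ᵐ x ∂E.measure, K.code l (x l) ≠ z := by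
      filter_upwards [ae_of_ae_map (f := (Finset.Ioo i k).restrict) (by fun_prop) hcon] with x hx
      exact hx
    have h4 : ∀ᵐ y ∂E.measure.map (fun x => x l), K.code l y ≠ z :=
      (ae_map_iff (f := fun x : Fin d → unitInterval => x l)
        (measurable_pi_apply l).aemeasurable (p := fun y => K.code l y ≠ z)
        (K.measurable_code l (measurableSet_singleton z)).compl).2 h3
    rw [E.isStochastic.map_eval l] at h4
    refine hz ?_
    rw [← K.volume_code l]
    simp only [ae_iff, not_not] at h4
    exact h4
  obtain ⟨t, ht, he, h0, h1, h2⟩ := (hex.and_eventually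
    (hae.and (h0.and (h1.and h2)))).exists
  rw [ht] at h0 h1 h2
  have hF1 : E.condCDF i (Finset.Ioo i k) a t = half := by
    ext
    refine (congrArg (fun μ : Measure unitInterval => μ.real (Set.Iic a)) h1).trans ?_
    simp only [Measure.real, ha, half]
    simp
  have hF2 : E.condCDF k (Finset.Ioo i k) b t = half := by
    ext
    refine (congrArg (fun μ : Measure unitInterval => μ.real (Set.Iic b)) h2).trans ?_
    simp only [Measure.real, hb, half]
    simp
  dsimp only at he
  rw [hF1, hF2, Copula.condPair, h0, map_measureReal_apply hm2 measurableSet_Iic] at he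
  rw [← he, map_measureReal_apply (by fun_prop) (measurableSet_Iic.prod measurableSet_Iic)]
  congr 1
  ext x
  simp [Pi.le_def, Fin.forall_fin_two]

theorem exists_boxFamily_not_isPartialDVine_self (K : IntervalCoding d ι)
    (hK : ∀ z, K.weight z ≤ 1 / 2) {i k : Fin d} (hik : (i : ℕ) + 2 ≤ k) :
    ∃ (M : _) (hM : K.IsBoxFamily M), ¬ (mixture hM i).IsPartialDVine (mixture hM i) := by
  classical
  have hne : i ≠ k := by rintro rfl; omega
  have hsum := K.sum_weight i
  obtain ⟨z, hz⟩ : ∃ z, K.weight z ≠ 0 := by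
    by_contra! h
    simp [h] at hsum
  -- The weights sum to 1 and none exceeds 1/2, so there is a second box of positive weight.
  obtain ⟨w, hwz, hw⟩ : ∃ w, w ≠ z ∧ K.weight w ≠ 0 := by
    by_contra! h
    rw [Finset.sum_eq_single z (fun w _ hw => h w hw) (by simp)] at hsum
    have := hK z
    rw [hsum] at this
    norm_num at this
  obtain ⟨a, ha⟩ := K.exists_median z i
  obtain ⟨b, hb⟩ := K.exists_median z k
  obtain ⟨a', ha'⟩ := K.exists_median w i
  obtain ⟨b', hb'⟩ := K.exists_median w k
  have hM := isBoxFamily_update (K := K) hne ha hb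
  refine ⟨_, hM, fun hself => ?_⟩
  have hbox : ∀ v, IndepFun (Finset.Ioo i k).restrict
      (fun x : Fin d → unitInterval => (x i, x k)) (K.box v) := fun v =>
    (indepFun_restrict_pi_pair _ (by simp) (by simp)).comp measurable_id
      ((measurable_pi_apply 0).prodMk (measurable_pi_apply 1))
  obtain ⟨c, hc⟩ := exists_const_of_isPartialDVine_self hM hik (fun v _ => by
    rcases eq_or_ne v z with rfl | h
    · rw [Function.update_self]
      exact (hbox v).cond_preimage (by fun_prop) (by fun_prop)
        (measurableSet_diagonal measurableSet_Iic measurableSet_Iic)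
        (box_diagonal_ne_zero hne hb)
    · rw [Function.update_of_ne h]; exact hbox v) hself
  -- The diagonal box `z` forces the constant to be 1/2, the product box `w` forces it to be 1/4.
  have h1 := hc z hz a b
  rw [Function.update_self, diagonalBox_map_eval hne ha hb, diagonalBox_map_eval hne ha hb,
    diagonalBox_map_pair hne, Measure.real,
    cond_diagonal_prod measurableSet_Iic measurableSet_Iic ha hb] at h1
  have h2 := hc w hw a' b'
  rw [Function.update_of_ne hwz, box_map_eval, box_map_eval, box_map_pair _ _ hne, Measure.real,
    Measure.prod_prod, ha', hb'] at h2
  have h3 := (h1 ha hb).trans (h2 rfl rfl).symm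
  norm_num at h3

end IntervalCoding

theorem dense_not_continuousAt {d : ℕ} (hd : 3 ≤ d) {ψ : ContCopula d → Copula d}
    (hψ : IsPartialDVineMap ψ) : Dense {C : ContCopula d | ¬ ContinuousAt ψ C} := by
  rw [Metric.dense_iff]
  intro C ε hε
  have hd0 : (0 : ℝ) < d := by positivity
  -- The first term of the minimum makes the mixture `ε / 2`-close; the second keeps all weights at
  -- most 1/2.
  obtain ⟨m, K, hK, hdist⟩ := C.1.exists_intervalCoding (δ := min (ε / (2 * d)) (1 / 2))
    (by positivity)
  obtain ⟨M, hM, hself⟩ := K.exists_boxFamily_not_isPartialDVine_self (fun z => by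
      refine (hK z (by omega)).trans ((ENNReal.ofReal_le_ofReal (min_le_right _ _)).trans ?_)
      rw [ENNReal.ofReal_div_of_pos (by norm_num)]; simp)
    (i := ⟨0, by omega⟩) (k := ⟨2, by omega⟩) le_rfl
  set E : ContCopula d := ⟨_, IntervalCoding.mixture_hasContinuousCondCDFs hM ⟨0, by omega⟩⟩
    with hE
  refine ⟨E, ?_, not_continuousAt_of_dist_ne_zero (by omega) hψ E fun h => hself ?_⟩
  · refine (hdist M hM ⟨0, by omega⟩).trans_lt ?_
    have h1 : (d : ℝ) * min (ε / (2 * d)) (1 / 2) ≤ d * (ε / (2 * d)) :=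
      mul_le_mul_of_nonneg_left (min_le_left _ _) hd0.le
    rw [show (d : ℝ) * (ε / (2 * d)) = ε / 2 by field_simp] at h1
    linarith
  · have h1 := hψ E
    rwa [← dist_eq_zero.1 h] at h1

end

theorem theorem7p6 (d : ℕ) (hd : 2 ≤ d) :
    (∃ ψ : ContCopula d → Copula d, IsPartialDVineMap ψ) ∧
    ∀ ψ : ContCopula d → Copula d, IsPartialDVineMap ψ →
      (∀ C : ContCopula d, dist C.1 (ψ C) ≠ 0 → ¬ ContinuousAt ψ C) ∧
      (3 ≤ d → Dense {C : ContCopula d | ¬ ContinuousAt ψ C}) :=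
  ⟨exists_isPartialDVineMap d, fun _ hψ => ⟨not_continuousAt_of_dist_ne_zero hd hψ,
    fun h => dense_not_continuousAt h hψ⟩⟩
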